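/- Let $\gamma$ be a simple closed regular real-analytic curve in $\mathbb{R}^2$ bounding a strictly convex compact region $\Omega_\gamma$ with $0\in\Omega_\gamma$. For $\xi\neq 0$ let $x_\gamma(\xi)$ be the unique point of $\gamma$ at which the outer unit normal is $\xi/\|\xi\|$, and put $Y_\gamma(\xi)=\langle \xi,x_\gamma(\xi)\rangle$. Let $\mathscr{S}_2=SL_2(\mathbb{R})/SL_2(\mathbb{Z})$ be the space of unimodular lattices of $\mathbb{R}^2$ (the class of $g$ being the lattice $g\mathbb{Z}^2$), let $\mu_2$ be its $SL_2(\mathbb{R})$-invariant probability measure, and let $\tilde\mu_2$ be a probability measure with a smooth bounded density with respect to $\mu_2$; the expectation $\mathbb{E}$ and laws are taken for $L$ distributed according to $\tilde\mu_2$. For almost every $L$ let $(e_1(L),e_2(L))$ be the unique pair of vectors of $L$ with positive first coordinates such that $\|e_i(L)\|=\|L\|_i$ for $i=1,2$, where $\|L\|_i$ is the least $r>0$ such that the closed ball of radius $r$ centred at $0$ contains $i$ linearly independent vectors of $L$. Let $$\Pi=\{(k_1,k_2)\in\mathbb{Z}^2 : \gcd(k_1,k_2)=1,\ k_1\ge 0,\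 \text{and } k_2=1 \text{ if } k_1=0\}.$$ For $k=(k_1,k_2)\in\Pi\cup(-\Pi)$ and $t\in\mathbb{R}$ let $\theta_k(L,t)=t\,Y_\gamma(k_1e_1(L)+k_2e_2(L)) \bmod 1\in\mathbb{R}/\mathbb{Z}$, and let $e(\theta)=\exp(2\pi i\theta)$. (1) For every $l\ge 1$, every $\psi\in C_c^\infty(\mathscr{S}_2)$, all distinct $k_1,\dots,k_l\in\Pi$ and all $(p_1,\dots,p_l)\in\mathbb{Z}^l\setminus\{0\}$, $$\mathbb{E}\Big(\psi(L)\,e\Big(\sum_{h=1}^l p_h\theta_{k_h}(L,t)\Big)\Big)\to 0\qquad (t\to\infty).$$ Consequently $(L,(\theta_k(L,t))_{k\in\Pi})$ converges in distribution, as $t\to\infty$, to $\tilde\mu_2\otimes\lambda^{\otimes\Pi}$, where $\lambda$ is the normalized Lebesgue measure on $\mathbb{R}/\mathbb{Z}$; that is, the phases become independent, uniformly distributed on $\mathbb{R}/\mathbb{Z}$ and independent of $L$. (2) Suppose that $\Omega_\gamma$ has no centre of symmetry. Then for every $l\ge 1$, every $\psi\in C_c^\infty(\mathscr{S}_2)$,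 all distinct $k_1,\dots,k_l\in\Pi$ and all $(p_{-l},\dots,p_{-1},p_1,\dots,p_l)\in\mathbb{Z}^{2l}\setminus\{0\}$, $$\mathbb{E}\Big(\psi(L)\,e\Big(\sum_{h=1}^l p_h\theta_{k_h}(L,t)+\sum_{h=1}^l p_{-h}\theta_{-k_h}(L,t)\Big)\Big)\to 0\qquad (t\to\infty).$$ Consequently $(L,(\theta_k(L,t))_{k\in\Pi},(\theta_{-k}(L,t))_{k\in\Pi})$ converges in distribution to $\tilde\mu_2\otimes\lambda^{\otimes\Pi}\otimes\lambda^{\otimes\Pi}$. -/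

import Mathlib

open MeasureTheory Filter Topology Matrix
open scoped ContDiff

noncomputable section

/-- The Euclidean plane `ℝ²`. -/
abbrev Plane : Type := EuclideanSpace ℝ (Fin 2)

/-! ### Analytic strictly convex curves and the function `Y_γ` -/

/-- `γ` (parametrised with period `1`) is a simple, closed, regular real-analytic curve, which bounds
the strictly convex compact region `Ω`, and this region contains the origin. -/
structure IsAnalyticOval (γ : ℝ → Plane) (Ω : Set Plane) : Prop where
  analytic : AnalyticOnNhd ℝ γ Set.univ
  regular : ∀ s, deriv γ s ≠ 0
  periodic : Function.Periodic γ 1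
  simple : Set.InjOn γ (Set.Ico 0 1)
  isCompact : IsCompact Ω
  strictConvex : StrictConvex ℝ Ω
  frontier_eq : frontier Ω = Set.range γ
  zero_mem : (0 : Plane) ∈ Ω

/-- `u` is the outer unit normal at the point `x` of the convex curve `γ`: the curve lies in the
closed half-plane bounded by the line through `x` orthogonal to `u`, on the side of `-u`. -/
def IsOuterNormalAt (γ : ℝ → Plane) (x u : Plane) : Prop :=
  x ∈ Set.range γ ∧ ‖u‖ = 1 ∧ ∀ s, inner ℝ u (γ s - x) ≤ 0

/-- `x_γ(ξ)`: the point of `γ` at which the outer unit normal is `ξ / ‖ξ‖`. -/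
def contactPoint (γ : ℝ → Plane) (ξ : Plane) : Plane :=
  Classical.epsilon fun x => IsOuterNormalAt γ x (‖ξ‖⁻¹ • ξ)

/-- For `ξ ≠ 0` there is exactly one such point. -/
theorem IsAnalyticOval.existsUnique_contactPoint {γ : ℝ → Plane} {Ω : Set Plane}
    (h : IsAnalyticOval γ Ω) {ξ : Plane} (hξ : ξ ≠ 0) :
    ∃! x, IsOuterNormalAt γ x (‖ξ‖⁻¹ • ξ) := by
  set u : Plane := ‖ξ‖⁻¹ • ξ with hu
  have hn : ‖u‖ = 1 := by
    rw [hu, norm_smul, norm_inv, norm_norm, inv_mul_cancel₀ (norm_ne_zero_iff.mpr hξ)]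
  have hcont : Continuous fun y : Plane => (inner ℝ u y : ℝ) := by fun_prop
  -- a maximiser of the linear form on `Ω` is not an interior point
  have hfr : ∀ x ∈ Ω, (∀ y ∈ Ω, (inner ℝ u y : ℝ) ≤ inner ℝ u x) → x ∉ interior Ω := by
    intro x _ hmax hint
    have hc : Continuous fun r : ℝ => x + r • u := by fun_prop
    have h0 : ∀ᶠ r : ℝ in 𝓝 0, x + r • u ∈ Ω := by
      have := hc.continuousAt (x := (0 : ℝ))
      apply this
      simpa using mem_interior_iff_mem_nhds.mp hint
    have h1 : ∀ᶠ r : ℝ in 𝓝[>] 0, x + r • u ∈ Ω ∧ r ∈ Set.Ioi (0 : ℝ) :=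
      (h0.filter_mono nhdsWithin_le_nhds).and self_mem_nhdsWithin
    obtain ⟨r, hrΩ, hr⟩ := h1.exists
    have := hmax _ hrΩ
    rw [inner_add_right, inner_smul_right, real_inner_self_eq_norm_sq, hn] at this
    have hr' : (0 : ℝ) < r := hr
    linarith
  have hclosed : closure Ω = Ω := h.isCompact.isClosed.closure_eq
  obtain ⟨x, hxΩ, hx⟩ := h.isCompact.exists_isMaxOn ⟨0, h.zero_mem⟩ hcont.continuousOn
  have hx' : ∀ y ∈ Ω, (inner ℝ u y : ℝ) ≤ inner ℝ u x := fun y hy => hx hy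
  have hγΩ : ∀ s, γ s ∈ Ω := fun s => by
    have : γ s ∈ frontier Ω := h.frontier_eq ▸ Set.mem_range_self s
    exact hclosed ▸ frontier_subset_closure this
  have hxγ : x ∈ Set.range γ := by
    rw [← h.frontier_eq]
    exact ⟨hclosed.symm ▸ hxΩ, hfr x hxΩ hx'⟩
  refine ⟨x, ⟨hxγ, hn, fun s => ?_⟩, ?_⟩
  · rw [inner_sub_right]
    linarith [hx' _ (hγΩ s)]
  · rintro y ⟨⟨s, rfl⟩, -, hy⟩
    by_contra hne
    obtain ⟨s', hs'⟩ := hxγ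
    have h1 : (inner ℝ u x : ℝ) ≤ inner ℝ u (γ s) := by
      have := hy s'
      rw [hs', inner_sub_right] at this
      linarith
    have hmid := h.strictConvex (hγΩ s) hxΩ hne (a := 1 / 2) (b := 1 / 2)
      (by norm_num) (by norm_num) (by norm_num)
    refine hfr _ (interior_subset hmid) (fun z hz => ?_) hmid
    rw [inner_add_right, inner_smul_right, inner_smul_right]
    linarith [hx' z hz]

/-- `Y_γ(ξ) = ⟨ξ, x_γ(ξ)⟩`. -/
def curveY (γ : ℝ → Plane) (ξ : Plane) : ℝ := inner ℝ ξ (contactPoint γ ξ)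

/-- `Ω` has a centre of symmetry. -/
def HasCenterOfSymmetry (Ω : Set Plane) : Prop :=
  ∃ c : Plane, ∀ x ∈ Ω, (2 : ℝ) • c - x ∈ Ω

/-! ### The space of unimodular lattices -/

/-- `SL₂(ℝ)`. -/
abbrev SL2R : Type := Matrix.SpecialLinearGroup (Fin 2) ℝ

/-- `SL₂(ℤ)` as a subgroup of `SL₂(ℝ)`. -/
def SL2Z : Subgroup SL2R :=
  (Matrix.SpecialLinearGroup.map (n := Fin 2) (Int.castRingHom ℝ)).range

/-- The space `𝒮₂ = SL₂(ℝ) / SL₂(ℤ)` of unimodular lattices of the plane, with the quotient topology;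
the class of `g` is the lattice `g ℤ²`. -/
abbrev LatticeSpace : Type := SL2R ⧸ SL2Z

instance : MeasurableSpace LatticeSpace := borel LatticeSpace
instance : BorelSpace LatticeSpace := ⟨rfl⟩

instance : SecondCountableTopology SL2R :=
  haveI : SecondCountableTopology (Matrix (Fin 2) (Fin 2) ℝ) :=
    inferInstanceAs (SecondCountableTopology (Fin 2 → Fin 2 → ℝ))
  Matrix.SpecialLinearGroup.isClosedEmbedding_val.isEmbedding.secondCountableTopology

instance : SecondCountableTopology LatticeSpace :=
  ContinuousConstSMul.secondCountableTopology

/-- The set of vectors of the lattice `L`. -/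
def latticeVectors (L : LatticeSpace) : Set Plane :=
  {v | ∃ g : SL2R, (g : LatticeSpace) = L ∧
    ∃ n : Fin 2 → ℤ, v = WithLp.toLp 2 (g.1 *ᵥ fun i => (n i : ℝ))}

/-- Smooth functions on `𝒮₂`: the lift to `SL₂(ℝ)` is a smooth function on this closed submanifold of
the space of `2 × 2` matrices, i.e. the restriction of a smooth function of the matrix entries. -/
def IsSmoothOnLattices {F : Type*} [NormedAddCommGroup F] [NormedSpace ℝ F]
    (f : LatticeSpace → F) : Prop :=
  ∃ G : (Fin 2 → Fin 2 → ℝ) → F, ContDiff ℝ ∞ G ∧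
    ∀ g : SL2R, f (g : LatticeSpace) = G fun i j => g.1 i j

/-- `‖L‖_i`: the least `r > 0` such that the closed ball `B(0, r)` contains `i` linearly independent
vectors of `L`. -/
def successiveMin (i : ℕ) (L : LatticeSpace) : ℝ :=
  sInf {r : ℝ | 0 < r ∧ ∃ v : Fin i → Plane,
    (∀ j, v j ∈ latticeVectors L ∧ ‖v j‖ ≤ r) ∧ LinearIndependent ℝ v}

/-- `e = (e₁, e₂)` is a pair of vectors of `L` with positive first coordinates which realise the two
successive minima of `L`. For almost every `L` there is exactly one such pair. -/
def IsMinimalPair (L : LatticeSpace) (e : Plane × Plane) : Prop :=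
  e.1 ∈ latticeVectors L ∧ e.2 ∈ latticeVectors L ∧ 0 < e.1 0 ∧ 0 < e.2 0 ∧
    ‖e.1‖ = successiveMin 1 L ∧ ‖e.2‖ = successiveMin 2 L

/-- The pair `(e₁(L), e₂(L))` (an arbitrary choice on the null set where it is not unique). -/
def minimalPair (L : LatticeSpace) : Plane × Plane :=
  Classical.epsilon (IsMinimalPair L)

/-- The vector `k₁ e₁(L) + k₂ e₂(L)`. -/
def latticeVec (k : ℤ × ℤ) (L : LatticeSpace) : Plane :=
  (k.1 : ℝ) • (minimalPair L).1 + (k.2 : ℝ) • (minimalPair L).2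

/-! ### The phases -/

/-- `Π`: the coprime pairs `(k₁, k₂)` with `k₁ ≥ 0`, where `k₁ = 0` is only allowed with `k₂ = 1`. -/
def PrimeIndex : Set (ℤ × ℤ) :=
  {k | IsCoprime k.1 k.2 ∧ 0 ≤ k.1 ∧ (k.1 = 0 → k.2 = 1)}

/-- `θ_k(L, t) = t Y_γ(k₁ e₁(L) + k₂ e₂(L)) mod 1`. -/
def phase (γ : ℝ → Plane) (k : ℤ × ℤ) (t : ℝ) (L : LatticeSpace) : UnitAddCircle :=
  ((t * curveY γ (latticeVec k L) : ℝ) : UnitAddCircle)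

/-- `e(θ) = exp(2πiθ)` for `θ ∈ ℝ/ℤ`. -/
def expCircle (θ : UnitAddCircle) : ℂ := (AddCircle.toCircle θ : ℂ)

/-- The product over `Π` of the normalised Lebesgue measure of `ℝ/ℤ`: the law of a family of
independent uniform phases indexed by `Π`. -/
def uniformPhases : Measure (PrimeIndex → UnitAddCircle) :=
  Measure.infinitePi fun _ => AddCircle.haarAddCircle

instance : IsProbabilityMeasure uniformPhases := by
  unfold uniformPhases; infer_instance

end

/-!
By the Riemann–Lebesgue lemma everything reduces to one claim: for distinct `k_h ∈ Π`, the law of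
`F(L) = ∑ (p_h Y(v_h) + q_h Y(-v_h))`, where `v_h = k_{h,1} e₁(L) + k_{h,2} e₂(L)`, is absolutely
continuous on `ℝ`. By Fubini and the invariance of `μ₂`, it suffices to move a generic `L` by a
two-parameter family of elements of `SL₂(ℝ)` and to show that the values of `F` avoid a given null
set for almost all parameters. The family is a diagonal flow followed by shears in a direction `η`.
On the countably many pieces where the reduced basis is a fixed basis of the starting lattice, it
moves each `v_h`, up to a common factor, along a line parallel to `η`, and homogeneity turns `F`
into a multiple of a sum `∑ H_i(s + λ τ_i)` with distinct `τ_i`, where `s` is the shear parameter,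
`λ` comes from the diagonal one and `H_i` is `p Y(ξ) + q Y(-ξ)` along the line. Each `H_i` is
analytic almost everywhere, because `Y` has gradient `x_γ` and the critical values of the normal
direction along `γ` form a null set by Sard. If the `s`-derivative of such a sum vanished on a set
of positive measure, differentiating along directions that kill the terms one at a time would make
`H_i` polynomial on some interval, for an index `i` of our choice.

A homogeneous function that is locally polynomial along lines in uncountably many directions is
affine along some line, since `P(y) = y Q(1/y)` forces degree at most one. If `p Y(ξ) + q Y(-ξ)` is
affine along a line, then `p x_γ(ξ) - q x_γ(-ξ)` is constant on it, so an arc of `γ`, and by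
analyticity all of `γ`, is mapped into `γ` by a homothety of ratio `p / q`, and conversely.
Compactness gives `|p| = |q|`, monotonicity of contact points gives `p q < 0`, hence `Ω` is
centrally symmetric.
-/

noncomputable section

/-! ### Linear algebra of the plane -/

/-- The determinant of the pair `v, w`. -/
def planeDet (v w : Plane) : ℝ := v 0 * w 1 - v 1 * w 0

theorem plane_ext {v w : Plane} (h0 : v 0 = w 0) (h1 : v 1 = w 1) : v = w := by
  ext i
  fin_cases i <;> assumption

theorem plane_inner_eq (v w : Plane) : (inner ℝ v w : ℝ) = v 0 * w 0 + v 1 * w 1 := by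
  simp [PiLp.inner_apply, Fin.sum_univ_two, mul_comm]

theorem eq_zero_of_inner_eq_zero {w w' v : Plane} (hw : planeDet w w' ≠ 0)
    (h : (inner ℝ w v : ℝ) = 0) (h' : (inner ℝ w' v : ℝ) = 0) : v = 0 := by
  rw [plane_inner_eq] at h h'
  refine plane_ext ((mul_eq_zero.1 ?_).resolve_left hw) ((mul_eq_zero.1 ?_).resolve_left hw)
  · unfold planeDet
    linear_combination w' 1 * h - w 1 * h'
  · unfold planeDet
    linear_combination -w' 0 * h + w 0 * h'

theorem smul_add_ne_zero {w w' : Plane} (hw : planeDet w w' ≠ 0) (τ : ℝ) : τ • w + w' ≠ 0 := by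
  refine fun h => hw ?_
  rw [eq_neg_of_add_eq_zero_right h]
  simp only [planeDet, PiLp.neg_apply, PiLp.smul_apply, smul_eq_mul]
  ring

theorem inner_smul_add_left (τ : ℝ) (w w' v : Plane) :
    (inner ℝ (τ • w + w') v : ℝ) = τ * inner ℝ w v + inner ℝ w' v := by
  rw [inner_add_left, real_inner_smul_left]

theorem neg_smul_add (τ : ℝ) (w w' : Plane) : -(τ • w + w') = τ • -w + -w' := by
  rw [neg_add, smul_neg]

theorem planeDet_neg_ne_zero {w w' : Plane} (hw : planeDet w w' ≠ 0) :
    planeDet (-w) (-w') ≠ 0 := by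
  simpa [planeDet] using hw

namespace IsAnalyticOval

variable {γ : ℝ → Plane} {Ω : Set Plane} {ξ ξ' w w' : Plane} {s τ : ℝ}

/-! ### The curve -/

theorem differentiable (h : IsAnalyticOval γ Ω) : Differentiable ℝ γ :=
  fun s => (h.analytic s trivial).differentiableAt

theorem continuous (h : IsAnalyticOval γ Ω) : Continuous γ := h.differentiable.continuous

theorem isCompact_range (h : IsAnalyticOval γ Ω) : IsCompact (Set.range γ) :=
  h.frontier_eq ▸
    h.isCompact.of_isClosed_subset isClosed_frontier h.isCompact.isClosed.frontier_subset

theorem apply_zero_ne_apply_half (h : IsAnalyticOval γ Ω) : γ 0 ≠ γ (1 / 2) := fun he => by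
  have := h.simple (x₁ := 0) (x₂ := 1 / 2) (by norm_num) (by norm_num) he
  norm_num at this

theorem nhdsWithin_range_le_map (h : IsAnalyticOval γ Ω) (s : ℝ) :
    𝓝[Set.range γ] (γ s) ≤ map γ (𝓝 s) := by
  have : Fact ((0 : ℝ) < 1) := ⟨one_pos⟩
  let Γ : AddCircle (1 : ℝ) → Plane := h.periodic.lift
  have hΓ : Γ ∘ (↑) = γ := rfl
  have hinj : Function.Injective Γ := by
    rw [← Set.injOn_univ, ← AddCircle.coe_image_Ico_eq (1 : ℝ) 0]
    rintro _ ⟨u, hu, rfl⟩ _ ⟨v, hv, rfl⟩ huv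
    rw [zero_add] at hu hv
    exact congrArg _ (h.simple hu hv huv)
  have hemb : IsClosedEmbedding Γ :=
    Continuous.isClosedEmbedding (continuous_coinduced_dom.2 h.continuous : Continuous Γ) hinj
  have hrange : Set.range γ = Set.range Γ := by
    rw [← hΓ, Set.range_comp, QuotientAddGroup.mk_surjective.range_eq, Set.image_univ]
  calc 𝓝[Set.range γ] (γ s) = map Γ (𝓝 (s : AddCircle (1 : ℝ))) := by
        rw [hemb.isEmbedding.map_nhds_eq, hrange]; rfl
    _ ≤ map Γ (map (↑) (𝓝 s)) := map_mono (QuotientAddGroup.isOpenMap_coe.nhds_le s)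
    _ = map γ (𝓝 s) := by rw [Filter.map_map, hΓ]

theorem exists_analyticAt_leftInverse {γ : ℝ → Plane} {s : ℝ} (hγ : AnalyticAt ℝ γ s)
    (hγ' : deriv γ s ≠ 0) :
    ∃ ρ : Plane → ℝ, AnalyticAt ℝ ρ (γ s) ∧ ∀ᶠ u in 𝓝 s, ρ (γ u) = u := by
  let ℓ : Plane →L[ℝ] ℝ := innerSL ℝ (deriv γ s)
  have hf : AnalyticAt ℝ (fun u => ℓ (γ u)) s := (ℓ.analyticAt _).comp hγ
  have hf' : deriv (fun u => ℓ (γ u)) s ≠ 0 := by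
    have hd : HasDerivAt (fun u => ℓ (γ u)) (ℓ (deriv γ s)) s :=
      ℓ.hasFDerivAt.comp_hasDerivAt s hγ.differentiableAt.hasDerivAt
    exact hd.deriv ▸ inner_self_ne_zero.2 hγ'
  exact ⟨_, (hf.analyticAt_localInverse hf').comp (ℓ.analyticAt (γ s)),
    hf.hasStrictDerivAt.eventually_left_inverse hf'⟩

theorem exists_analyticAt_retraction (h : IsAnalyticOval γ Ω) (s : ℝ) :
    ∃ ρ : Plane → ℝ, AnalyticAt ℝ ρ (γ s) ∧ ρ (γ s) = s ∧
      ∀ᶠ x in 𝓝[Set.range γ] (γ s), γ (ρ x) = x := by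
  obtain ⟨ρ, hρ, hρs⟩ := exists_analyticAt_leftInverse (h.analytic s trivial) (h.regular s)
  exact ⟨ρ, hρ, hρs.self_of_nhds, h.nhdsWithin_range_le_map s (hρs.mono fun _ => congrArg γ)⟩

theorem mem_range_of_eventually_mem_range (h : IsAnalyticOval γ Ω) {δ : ℝ → Plane}
    (hδ : AnalyticOnNhd ℝ δ Set.univ) (hs : ∀ᶠ u in 𝓝 s, δ u ∈ Set.range γ) (u : ℝ) :
    δ u ∈ Set.range γ := by
  -- the identity theorem for `δ - γ ∘ ρ ∘ δ` shows that the open set `S` is closed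
  let S : Set ℝ := {u | ∀ᶠ v in 𝓝 u, δ v ∈ Set.range γ}
  suffices hclosed : IsClosed S by
    have huniv : S = Set.univ :=
      IsClopen.eq_univ ⟨hclosed, isOpen_setOfPred_eventually_nhds⟩ ⟨s, hs⟩
    exact (huniv ▸ Set.mem_univ u : u ∈ S).self_of_nhds
  have hδc : Continuous δ := continuous_iff_continuousAt.2 fun v => (hδ v trivial).continuousAt
  refine isClosed_of_closure_subset fun v hv => ?_
  obtain ⟨a, ha⟩ : δ v ∈ Set.range γ :=
    closure_minimal (fun _ hx => hx.self_of_nhds) (h.isCompact_range.isClosed.preimage hδc) hv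
  obtain ⟨ρ, hρ, hρa, hργ⟩ := h.exists_analyticAt_retraction a
  rw [ha] at hρ hργ
  have hΔ : AnalyticAt ℝ (fun x => δ x - γ (ρ (δ x))) v :=
    (hδ v trivial).sub ((h.analytic _ trivial).comp (hρ.comp (hδ v trivial)))
  have hzero : ∀ᶠ x in 𝓝 v, δ x ∈ Set.range γ → δ x - γ (ρ (δ x)) = 0 := by
    filter_upwards [hδc.continuousAt.eventually (eventually_nhdsWithin_iff.1 hργ)] with x hx hxγ
    rw [hx hxγ, sub_self]
  have hfreq : ∃ᶠ x in 𝓝[≠] v, δ x - γ (ρ (δ x)) = 0 := by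
    have hv' : v ∈ closure (S ∩ {v}ᶜ) := closure_minimal
      ((dense_compl_singleton v).open_subset_closure_inter isOpen_setOfPred_eventually_nhds)
      isClosed_closure hv
    refine frequently_nhdsWithin_iff.2
      (((mem_closure_iff_frequently.1 hv').and_eventually hzero).mono ?_)
    exact fun x hx => ⟨hx.2 hx.1.1.self_of_nhds, hx.1.2⟩
  filter_upwards [hΔ.frequently_zero_iff_eventually_zero.1 hfreq] with x hx
  exact ⟨_, (sub_eq_zero.1 hx).symm⟩

/-! ### Contact points and the support function -/

theorem isOuterNormalAt_contactPoint (h : IsAnalyticOval γ Ω) (hξ : ξ ≠ 0) :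
    IsOuterNormalAt γ (contactPoint γ ξ) (‖ξ‖⁻¹ • ξ) :=
  Classical.epsilon_spec (h.existsUnique_contactPoint hξ).exists

theorem contactPoint_mem_range (h : IsAnalyticOval γ Ω) (hξ : ξ ≠ 0) :
    contactPoint γ ξ ∈ Set.range γ := (h.isOuterNormalAt_contactPoint hξ).1

theorem isOuterNormalAt_iff {x : Plane} (hξ : ξ ≠ 0) :
    IsOuterNormalAt γ x (‖ξ‖⁻¹ • ξ) ↔
      x ∈ Set.range γ ∧ ∀ s, (inner ℝ ξ (γ s) : ℝ) ≤ inner ℝ ξ x := by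
  have hpos : 0 < ‖ξ‖⁻¹ := inv_pos.2 (norm_pos_iff.2 hξ)
  have hnorm : ‖‖ξ‖⁻¹ • ξ‖ = 1 := norm_smul_inv_norm (𝕜 := ℝ) hξ
  simp only [IsOuterNormalAt, hnorm, true_and, real_inner_smul_left, inner_sub_right,
    sub_nonpos, mul_le_mul_iff_right₀ hpos]

theorem inner_le_curveY (h : IsAnalyticOval γ Ω) (ξ : Plane) (s : ℝ) :
    (inner ℝ ξ (γ s) : ℝ) ≤ curveY γ ξ := by
  obtain rfl | hξ := eq_or_ne ξ 0
  · simp [curveY]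
  · exact ((isOuterNormalAt_iff hξ).1 (h.isOuterNormalAt_contactPoint hξ)).2 s

theorem eq_contactPoint_iff (h : IsAnalyticOval γ Ω) (hξ : ξ ≠ 0) :
    γ s = contactPoint γ ξ ↔ inner ℝ ξ (γ s) = curveY γ ξ := by
  refine ⟨fun hs => by rw [hs, curveY], fun hs => (h.existsUnique_contactPoint hξ).unique ?_
    (h.isOuterNormalAt_contactPoint hξ)⟩
  exact (isOuterNormalAt_iff hξ).2 ⟨⟨s, rfl⟩, fun u => (h.inner_le_curveY ξ u).trans hs.ge⟩

theorem exists_curveY_eq_inner (h : IsAnalyticOval γ Ω) (ξ : Plane) :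
    ∃ s, curveY γ ξ = inner ℝ ξ (γ s) := by
  obtain rfl | hξ := eq_or_ne ξ 0
  · exact ⟨0, by simp [curveY]⟩
  · obtain ⟨s, hs⟩ := h.contactPoint_mem_range hξ
    exact ⟨s, by rw [curveY, hs]⟩

theorem curveY_smul (h : IsAnalyticOval γ Ω) (ξ : Plane) {c : ℝ} (hc : 0 < c) :
    curveY γ (c • ξ) = c * curveY γ ξ := by
  refine le_antisymm ?_ ?_
  · obtain ⟨s, hs⟩ := h.exists_curveY_eq_inner (c • ξ)
    rw [hs, real_inner_smul_left]
    exact mul_le_mul_of_nonneg_left (h.inner_le_curveY ξ s) hc.le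
  · obtain ⟨s, hs⟩ := h.exists_curveY_eq_inner ξ
    rw [hs, ← real_inner_smul_left]
    exact h.inner_le_curveY _ s

theorem continuous_curveY (h : IsAnalyticOval γ Ω) : Continuous (curveY γ) := by
  obtain ⟨C, hC⟩ := h.isCompact_range.isBounded.exists_norm_le
  refine (LipschitzWith.of_le_add_mul C.toNNReal fun ξ ξ' => ?_).continuous
  obtain ⟨s, hs⟩ := h.exists_curveY_eq_inner ξ
  have hinner : (inner ℝ (ξ - ξ') (γ s) : ℝ) ≤ C.toNNReal * dist ξ ξ' := by
    rw [dist_eq_norm, mul_comm]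
    exact (real_inner_le_norm _ _).trans (mul_le_mul_of_nonneg_left
      ((hC _ ⟨s, rfl⟩).trans (Real.le_coe_toNNReal C)) (norm_nonneg _))
  rw [inner_sub_left] at hinner
  linarith [h.inner_le_curveY ξ' s]

theorem continuousAt_contactPoint (h : IsAnalyticOval γ Ω) (hξ : ξ ≠ 0) :
    ContinuousAt (contactPoint γ) ξ := by
  refine h.isCompact_range.tendsto_nhds_of_unique_mapClusterPt
    ((eventually_ne_nhds hξ).mono fun _ => h.contactPoint_mem_range) ?_
  rintro _ ⟨s, rfl⟩ hs
  obtain ⟨U, hU, hUs⟩ := mapClusterPt_iff_ultrafilter.1 hs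
  refine (h.eq_contactPoint_iff hξ).2 (tendsto_nhds_unique (f := curveY γ) ?_
    (h.continuous_curveY.continuousAt.mono_left hU))
  exact (tendsto_id'.2 hU).inner hUs

theorem inner_sub_contactPoint_le (h : IsAnalyticOval γ Ω) (hξ : ξ ≠ 0) (ξ' : Plane) :
    (inner ℝ (ξ' - ξ) (contactPoint γ ξ) : ℝ) ≤ curveY γ ξ' - curveY γ ξ := by
  obtain ⟨s, hs⟩ := h.contactPoint_mem_range hξ
  rw [inner_sub_left, curveY.eq_def γ ξ, ← hs]
  linarith [h.inner_le_curveY ξ' s]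

theorem hasGradientAt_curveY (h : IsAnalyticOval γ Ω) (hξ : ξ ≠ 0) :
    HasGradientAt (curveY γ) (contactPoint γ ξ) ξ := by
  rw [hasGradientAt_iff_isLittleO]
  have hcont : Tendsto (fun ξ' => ‖contactPoint γ ξ' - contactPoint γ ξ‖) (𝓝 ξ) (𝓝 0) :=
    tendsto_iff_norm_sub_tendsto_zero.1 (h.continuousAt_contactPoint hξ)
  refine Asymptotics.isLittleO_iff.2 fun c hc => ?_
  filter_upwards [hcont.eventually (gt_mem_nhds hc), eventually_ne_nhds hξ] with ξ' hξ'c hξ'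
  have hlower := h.inner_sub_contactPoint_le hξ ξ'
  have hupper := h.inner_sub_contactPoint_le hξ' ξ
  have hgap : (inner ℝ (ξ' - ξ) (contactPoint γ ξ' - contactPoint γ ξ) : ℝ) ≤ c * ‖ξ' - ξ‖ :=
    (real_inner_le_norm _ _).trans (by rw [mul_comm]; gcongr)
  rw [← neg_sub ξ', inner_neg_left] at hupper
  rw [inner_sub_right] at hgap
  rw [real_inner_comm, Real.norm_of_nonneg (by linarith)]
  linarith

theorem inner_deriv_eq_zero (h : IsAnalyticOval γ Ω) (hξ : ξ ≠ 0)
    (hs : γ s = contactPoint γ ξ) : (inner ℝ ξ (deriv γ s) : ℝ) = 0 := by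
  have hmax : IsLocalMax (fun u => (inner ℝ ξ (γ u) : ℝ)) s := Eventually.of_forall fun u =>
    (h.inner_le_curveY ξ u).trans ((h.eq_contactPoint_iff hξ).1 hs).ge
  exact hmax.hasDerivAt_eq_zero
    ((innerSL ℝ ξ).hasFDerivAt.comp_hasDerivAt s (h.differentiable s).hasDerivAt)

/-! ### Lines of normal directions -/

/-- The value `τ` for which the tangent of `γ` at `γ s` is orthogonal to `τ • w + w'`; it is the
inverse of the motion of the contact point when the normal direction moves along a line. -/
def normalParam (γ : ℝ → Plane) (w w' : Plane) (s : ℝ) : ℝ :=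
  -(inner ℝ w' (deriv γ s)) / inner ℝ w (deriv γ s)

theorem inner_deriv_ne_zero (h : IsAnalyticOval γ Ω) (hw : planeDet w w' ≠ 0)
    (hs : γ s = contactPoint γ (τ • w + w')) : (inner ℝ w (deriv γ s) : ℝ) ≠ 0 := by
  intro h0
  have hτ := h.inner_deriv_eq_zero (smul_add_ne_zero hw τ) hs
  rw [inner_smul_add_left, h0, mul_zero, zero_add] at hτ
  exact h.regular s (eq_zero_of_inner_eq_zero hw h0 hτ)

theorem normalParam_eq (h : IsAnalyticOval γ Ω) (hw : planeDet w w' ≠ 0)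
    (hs : γ s = contactPoint γ (τ • w + w')) : normalParam γ w w' s = τ := by
  have hτ := h.inner_deriv_eq_zero (smul_add_ne_zero hw τ) hs
  rw [inner_smul_add_left] at hτ
  rw [normalParam, div_eq_iff (h.inner_deriv_ne_zero hw hs)]
  linarith

theorem contactPoint_line_injective (h : IsAnalyticOval γ Ω) (hw : planeDet w w' ≠ 0) :
    Function.Injective fun τ : ℝ => contactPoint γ (τ • w + w') := by
  intro τ τ' he
  obtain ⟨s, hs⟩ := h.contactPoint_mem_range (smul_add_ne_zero hw τ)
  rw [← h.normalParam_eq hw hs, ← h.normalParam_eq hw (hs.trans he)]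

theorem analyticAt_normalParam (h : IsAnalyticOval γ Ω) (hs : (inner ℝ w (deriv γ s) : ℝ) ≠ 0) :
    AnalyticAt ℝ (normalParam γ w w') s := by
  have hinner (v : Plane) : AnalyticAt ℝ (fun u => (inner ℝ v (deriv γ u) : ℝ)) s :=
    ((innerSL ℝ v).analyticAt _).comp (h.analytic.deriv s trivial)
  exact (hinner w').neg.div (hinner w) hs

theorem continuousAt_contactPoint_line (h : IsAnalyticOval γ Ω) (hw : planeDet w w' ≠ 0) (τ : ℝ) :
    ContinuousAt (fun x : ℝ => contactPoint γ (x • w + w')) τ :=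
  (h.continuousAt_contactPoint (smul_add_ne_zero hw τ)).comp (f := fun x : ℝ => x • w + w')
    (by fun_prop)

theorem exists_analyticAt_param (h : IsAnalyticOval γ Ω) (hw : planeDet w w' ≠ 0)
    (hs : γ s = contactPoint γ (τ • w + w')) (hs' : deriv (normalParam γ w w') s ≠ 0) :
    ∃ ι : ℝ → ℝ, AnalyticAt ℝ ι τ ∧ (∀ᶠ x in 𝓝 τ, contactPoint γ (x • w + w') = γ (ι x)) ∧
      ∀ᶠ u in 𝓝 s, ι (normalParam γ w w' u) = u := by
  have hn := h.analyticAt_normalParam (w' := w') (h.inner_deriv_ne_zero hw hs)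
  have hnτ := h.normalParam_eq hw hs
  have hleft := hn.hasStrictDerivAt.eventually_left_inverse hs'
  refine ⟨_, hnτ ▸ hn.analyticAt_localInverse hs', ?_, hleft⟩
  obtain ⟨ρ, hρ, hρs, hργ⟩ := h.exists_analyticAt_retraction s
  have hcont := h.continuousAt_contactPoint_line hw τ
  rw [ContinuousAt, ← hs] at hcont
  have hρx : Tendsto (fun x : ℝ => ρ (contactPoint γ (x • w + w'))) (𝓝 τ) (𝓝 (ρ (γ s))) :=
    hρ.continuousAt.tendsto.comp hcont
  rw [hρs] at hρx
  have hcont' := tendsto_nhdsWithin_iff.2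
    ⟨hcont, Eventually.of_forall fun x => h.contactPoint_mem_range (smul_add_ne_zero hw x)⟩
  filter_upwards [hcont'.eventually hργ, hρx.eventually hleft] with x hx hx'
  rw [h.normalParam_eq hw hx] at hx'
  rw [hx', hx]

theorem analyticAt_curveY_line (h : IsAnalyticOval γ Ω) (hw : planeDet w w' ≠ 0)
    (hs : γ s = contactPoint γ (τ • w + w')) (hs' : deriv (normalParam γ w w') s ≠ 0) :
    AnalyticAt ℝ (fun x : ℝ => curveY γ (x • w + w')) τ := by
  obtain ⟨ι, hι, hγι, -⟩ := h.exists_analyticAt_param hw hs hs'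
  have hγ (v : Plane) : AnalyticAt ℝ (fun x => (inner ℝ v (γ (ι x)) : ℝ)) τ :=
    ((innerSL ℝ v).analyticAt _).comp ((h.analytic _ trivial).comp hι)
  refine ((analyticAt_id.mul (hγ w)).add (hγ w')).congr ?_
  filter_upwards [hγι] with x hx
  simp only [curveY, hx, inner_smul_add_left, Pi.add_apply, Pi.mul_apply, id]

theorem ae_deriv_normalParam_ne_zero (h : IsAnalyticOval γ Ω) (hw : planeDet w w' ≠ 0) :
    ∀ᵐ τ : ℝ, ∀ s, γ s = contactPoint γ (τ • w + w') → deriv (normalParam γ w w') s ≠ 0 := by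
  let C : Set ℝ := {s | (inner ℝ w (deriv γ s) : ℝ) ≠ 0 ∧ deriv (normalParam γ w w') s = 0}
  have hC : volume (normalParam γ w w' '' C) = 0 := by
    refine addHaar_image_eq_zero_of_det_fderivWithin_eq_zero volume (f' := fun _ => 0)
      (fun s hs => ?_) fun s _ => by simp [ContinuousLinearMap.det]
    have hd := (h.analyticAt_normalParam (w' := w') hs.1).differentiableAt.hasDerivAt
    rw [hs.2] at hd
    simpa using hd.hasFDerivAt.hasFDerivWithinAt
  filter_upwards [measure_eq_zero_iff_ae_notMem.1 hC] with τ hτ s hs hs'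
  exact hτ ⟨s, ⟨h.inner_deriv_ne_zero hw hs, hs'⟩, h.normalParam_eq hw hs⟩

theorem ae_analyticAt_curveY_line (h : IsAnalyticOval γ Ω) (hw : planeDet w w' ≠ 0) :
    ∀ᵐ τ : ℝ, AnalyticAt ℝ (fun x : ℝ => curveY γ (x • w + w')) τ := by
  filter_upwards [h.ae_deriv_normalParam_ne_zero hw] with τ hτ
  obtain ⟨s, hs⟩ := h.contactPoint_mem_range (smul_add_ne_zero hw τ)
  exact h.analyticAt_curveY_line hw hs (hτ s hs)

theorem hasDerivAt_curveY_line (h : IsAnalyticOval γ Ω) (hw : planeDet w w' ≠ 0) (τ : ℝ) :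
    HasDerivAt (fun x : ℝ => curveY γ (x • w + w'))
      (inner ℝ w (contactPoint γ (τ • w + w'))) τ := by
  have hline : HasDerivAt (fun x : ℝ => x • w + w') w τ := by
    simpa using ((hasDerivAt_id τ).smul_const w).add_const w'
  rw [real_inner_comm]
  exact (h.hasGradientAt_curveY (smul_add_ne_zero hw τ)).hasFDerivAt.comp_hasDerivAt τ hline

theorem strictMono_inner_contactPoint (h : IsAnalyticOval γ Ω) (hw : planeDet w w' ≠ 0) :
    StrictMono fun τ : ℝ => (inner ℝ w (contactPoint γ (τ • w + w')) : ℝ) := by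
  intro τ τ' hτ
  have hne : contactPoint γ (τ • w + w') ≠ contactPoint γ (τ' • w + w') :=
    fun he => hτ.ne (h.contactPoint_line_injective hw he)
  obtain ⟨s, hs⟩ := h.contactPoint_mem_range (smul_add_ne_zero hw τ)
  obtain ⟨s', hs'⟩ := h.contactPoint_mem_range (smul_add_ne_zero hw τ')
  have hlt : (inner ℝ (τ' • w + w') (γ s) : ℝ) < inner ℝ (τ' • w + w') (γ s') := by
    rw [(h.eq_contactPoint_iff (smul_add_ne_zero hw τ')).1 hs']
    refine (h.inner_le_curveY _ s).lt_of_ne fun he => hne ?_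
    rw [← hs, (h.eq_contactPoint_iff (smul_add_ne_zero hw τ')).2 he]
  have hle : (inner ℝ (τ • w + w') (γ s') : ℝ) ≤ inner ℝ (τ • w + w') (γ s) := by
    rw [(h.eq_contactPoint_iff (smul_add_ne_zero hw τ)).1 hs]
    exact h.inner_le_curveY _ s'
  simp only [← hs, ← hs', inner_smul_add_left] at hlt hle ⊢
  nlinarith

/-! ### Homotheties -/

theorem abs_le_one_of_homothety (h : IsAnalyticOval γ Ω) {r : ℝ} {c : Plane}
    (hr : ∀ s, r • γ s + c ∈ Set.range γ) : |r| ≤ 1 := by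
  have hb : Bornology.IsBounded (Set.range γ) := h.isCompact_range.isBounded
  have hpos : 0 < Metric.diam (Set.range γ) := (dist_pos.2 h.apply_zero_ne_apply_half).trans_le
    (Metric.dist_le_diam_of_mem hb ⟨0, rfl⟩ ⟨1 / 2, rfl⟩)
  by_contra! hcon
  have hr0 : 0 < |r| := one_pos.trans hcon
  have hdiam : Metric.diam (Set.range γ) ≤ Metric.diam (Set.range γ) / |r| := by
    refine Metric.diam_le_of_forall_dist_le (by positivity) ?_
    rintro _ ⟨s, rfl⟩ _ ⟨u, rfl⟩
    rw [le_div_iff₀' hr0]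
    calc |r| * dist (γ s) (γ u) = dist (r • γ s + c) (r • γ u + c) := by
          rw [dist_add_right, dist_smul₀, Real.norm_eq_abs]
      _ ≤ Metric.diam (Set.range γ) := Metric.dist_le_diam_of_mem hb (hr s) (hr u)
  exact hdiam.not_gt (div_lt_self hpos hcon)

theorem mem_region (h : IsAnalyticOval γ Ω) (s : ℝ) : γ s ∈ Ω :=
  h.isCompact.isClosed.frontier_subset (h.frontier_eq ▸ Set.mem_range_self s)

theorem inner_le_curveY_of_mem (h : IsAnalyticOval γ Ω) (hξ : ξ ≠ 0) {x : Plane} (hx : x ∈ Ω) :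
    (inner ℝ ξ x : ℝ) ≤ curveY γ ξ := by
  obtain ⟨y, hy, hmax⟩ := h.isCompact.exists_isMaxOn ⟨x, hx⟩ (innerSL ℝ ξ).continuous.continuousOn
  have hyi : y ∉ interior Ω := fun hi => by
    have h0 := (hmax.isLocalMax (mem_interior_iff_mem_nhds.1 hi)).hasFDerivAt_eq_zero
      (innerSL ℝ ξ).hasFDerivAt
    exact hξ (inner_self_eq_zero.1 (congrArg (fun f : Plane →L[ℝ] ℝ => f ξ) h0))
  obtain ⟨s, rfl⟩ : y ∈ Set.range γ := h.frontier_eq ▸ ⟨subset_closure hy, hyi⟩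
  exact (hmax hx).trans (h.inner_le_curveY ξ s)

theorem hasCenterOfSymmetry_of_reflection (h : IsAnalyticOval γ Ω) {c : Plane}
    (hc : ∀ s, c - γ s ∈ Set.range γ) : HasCenterOfSymmetry Ω := by
  refine ⟨(2 : ℝ)⁻¹ • c, fun x hx => ?_⟩
  rw [smul_inv_smul₀ two_ne_zero]
  by_contra hn
  obtain ⟨f, u, hf, hu⟩ := geometric_hahn_banach_closed_point h.strictConvex.convex
    h.isCompact.isClosed hn
  obtain ⟨ξ, rfl⟩ := (InnerProductSpace.toDual ℝ Plane).surjective f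
  simp only [InnerProductSpace.toDual_apply_apply, inner_sub_right] at hf hu
  have hξ : -ξ ≠ 0 := neg_ne_zero.2 fun h0 => by
    have := (hf x hx).trans hu
    simp [h0] at this
  obtain ⟨s, hs⟩ := h.exists_curveY_eq_inner (-ξ)
  have hlower := h.inner_le_curveY_of_mem hξ hx
  obtain ⟨s', hs'⟩ := hc s
  have hupper := hf _ (h.mem_region s')
  rw [hs', inner_sub_right] at hupper
  rw [hs, inner_neg_left, inner_neg_left] at hlower
  linarith

theorem homothety_mem_range (h : IsAnalyticOval γ Ω) (hw : planeDet w w' ≠ 0) {r : ℝ} {c : Plane}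
    (hc : ∀ᶠ x in 𝓝 τ, r • contactPoint γ (x • w + w') + c ∈ Set.range γ) (u : ℝ) :
    r • γ u + c ∈ Set.range γ := by
  obtain ⟨τ₁, hreg, hτ₁⟩ := (Measure.dense_of_ae
    (h.ae_deriv_normalParam_ne_zero hw)).exists_mem_open isOpen_setOfPred_eventually_nhds ⟨τ, hc⟩
  obtain ⟨s, hs⟩ := h.contactPoint_mem_range (smul_add_ne_zero hw τ₁)
  obtain ⟨ι, -, hγι, hι⟩ := h.exists_analyticAt_param hw hs (hreg s hs)
  have hcont := (h.analyticAt_normalParam (w' := w') (h.inner_deriv_ne_zero hw hs)).continuousAt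
  rw [ContinuousAt, h.normalParam_eq hw hs] at hcont
  refine h.mem_range_of_eventually_mem_range (s := s) (δ := fun u => r • γ u + c)
    (fun v hv => (h.analytic v hv).fun_const_smul.add analyticAt_const) ?_ u
  filter_upwards [hcont.eventually hτ₁, hcont.eventually hγι, hι] with v hv hvγ hvι
  rwa [hvγ, hvι] at hv

end IsAnalyticOval

/-! ### The function `p Y(ξ) + q Y(-ξ)` -/

/-- The function `p Y(ξ) + q Y(-ξ)`, which governs the oscillation of `p θ_k + q θ_{-k}`. -/
def twoSidedY (γ : ℝ → Plane) (p q : ℝ) (ξ : Plane) : ℝ := p * curveY γ ξ + q * curveY γ (-ξ)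

namespace IsAnalyticOval

variable {γ : ℝ → Plane} {Ω : Set Plane} {w w' : Plane} {τ : ℝ}

theorem continuous_twoSidedY (h : IsAnalyticOval γ Ω) (p q : ℝ) :
    Continuous (twoSidedY γ p q) :=
  (h.continuous_curveY.const_mul p).add
    ((h.continuous_curveY.comp continuous_neg).const_mul q)

theorem twoSidedY_smul (h : IsAnalyticOval γ Ω) (p q : ℝ) (ξ : Plane) {c : ℝ} (hc : 0 < c) :
    twoSidedY γ p q (c • ξ) = c * twoSidedY γ p q ξ := by
  rw [twoSidedY, twoSidedY, ← smul_neg, h.curveY_smul _ hc, h.curveY_smul _ hc]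
  ring

theorem ae_analyticAt_twoSidedY_line (h : IsAnalyticOval γ Ω) (p q : ℝ)
    (hw : planeDet w w' ≠ 0) :
    ∀ᵐ τ : ℝ, AnalyticAt ℝ (fun x : ℝ => twoSidedY γ p q (x • w + w')) τ := by
  filter_upwards [h.ae_analyticAt_curveY_line hw,
    h.ae_analyticAt_curveY_line (planeDet_neg_ne_zero hw)] with τ hτ hτ'
  simp only [twoSidedY, neg_smul_add]
  exact (analyticAt_const.mul hτ).add (analyticAt_const.mul hτ')

theorem hasDerivAt_twoSidedY_line (h : IsAnalyticOval γ Ω) (p q : ℝ) (hw : planeDet w w' ≠ 0)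
    (τ : ℝ) :
    HasDerivAt (fun x : ℝ => twoSidedY γ p q (x • w + w'))
      (p * inner ℝ w (contactPoint γ (τ • w + w')) +
        q * inner ℝ (-w) (contactPoint γ (τ • -w + -w'))) τ := by
  simp only [twoSidedY, neg_smul_add]
  exact ((h.hasDerivAt_curveY_line hw τ).const_mul p).add
    ((h.hasDerivAt_curveY_line (planeDet_neg_ne_zero hw) τ).const_mul q)

section Affine

variable {p q α β : ℝ}

theorem mul_neg_of_mul_add_mul_eq_zero {a b : ℝ} (hpq : p ≠ 0 ∨ q ≠ 0) (ha : 0 < a) (hb : 0 < b)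
    (hab : p * a + q * b = 0) : p * q < 0 := by
  rcases lt_trichotomy p 0 with hp | rfl | hp
  · exact mul_neg_of_neg_of_pos hp (by nlinarith)
  · simp_all [hb.ne']
  · exact mul_neg_of_pos_of_neg hp (by nlinarith)

theorem eventually_inner_eq_of_affine (h : IsAnalyticOval γ Ω) (hw : planeDet w w' ≠ 0)
    (haff : ∀ᶠ x in 𝓝 τ, twoSidedY γ p q (x • w + w') = α * x + β) :
    ∀ᶠ x in 𝓝 τ, p * inner ℝ w (contactPoint γ (x • w + w')) +
      q * inner ℝ (-w) (contactPoint γ (x • -w + -w')) = α := by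
  filter_upwards [haff.eventually_nhds] with x hx
  have hlin : HasDerivAt (fun x : ℝ => α * x + β) α x := by
    simpa using ((hasDerivAt_id x).const_mul α).add_const β
  exact (h.hasDerivAt_twoSidedY_line p q hw x).unique (hlin.congr_of_eventuallyEq hx)

theorem eventually_contactPoint_sub_eq_of_affine (h : IsAnalyticOval γ Ω)
    (hw : planeDet w w' ≠ 0)
    (haff : ∀ᶠ x in 𝓝 τ, twoSidedY γ p q (x • w + w') = α * x + β) :
    ∃ c : Plane, ∀ᶠ x in 𝓝 τ,
      p • contactPoint γ (x • w + w') - q • contactPoint γ (x • -w + -w') = c := by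
  let X (x : ℝ) : Plane := p • contactPoint γ (x • w + w') - q • contactPoint γ (x • -w + -w')
  have hX : ∀ᶠ x in 𝓝 τ, inner ℝ w (X x) = α ∧ inner ℝ w' (X x) = β := by
    filter_upwards [h.eventually_inner_eq_of_affine hw haff, haff] with x hx hx'
    rw [twoSidedY, neg_smul_add, curveY, curveY, inner_smul_add_left, inner_smul_add_left] at hx'
    simp only [X, inner_sub_right, inner_smul_right, inner_neg_left] at hx hx' ⊢
    exact ⟨by linarith, by linear_combination hx' - x * hx⟩
  refine ⟨X τ, hX.mono fun x hx => sub_eq_zero.1 (eq_zero_of_inner_eq_zero hw ?_ ?_)⟩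
  · rw [inner_sub_right, hx.1, hX.self_of_nhds.1, sub_self]
  · rw [inner_sub_right, hx.2, hX.self_of_nhds.2, sub_self]

theorem mul_neg_of_affine (h : IsAnalyticOval γ Ω) (hpq : p ≠ 0 ∨ q ≠ 0)
    (hw : planeDet w w' ≠ 0)
    (haff : ∀ᶠ x in 𝓝 τ, twoSidedY γ p q (x • w + w') = α * x + β) : p * q < 0 := by
  have hα := h.eventually_inner_eq_of_affine hw haff
  obtain ⟨τ', hτ', hττ'⟩ : ∃ τ', (p * inner ℝ w (contactPoint γ (τ' • w + w')) +
      q * inner ℝ (-w) (contactPoint γ (τ' • -w + -w')) = α) ∧ τ < τ' :=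
    ((hα.filter_mono nhdsWithin_le_nhds).and (self_mem_nhdsWithin (s := Set.Ioi τ))).exists
  have hpos := h.strictMono_inner_contactPoint hw hττ'
  have hneg := h.strictMono_inner_contactPoint (planeDet_neg_ne_zero hw) hττ'
  exact mul_neg_of_mul_add_mul_eq_zero hpq (sub_pos.2 hpos) (sub_pos.2 hneg)
    (by linear_combination hτ' - hα.self_of_nhds)

theorem homothety_mem_range_of_contactPoint_sub_eq (h : IsAnalyticOval γ Ω) (hq : q ≠ 0)
    (hw : planeDet w w' ≠ 0) {c : Plane}
    (hc : ∀ᶠ x in 𝓝 τ,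
      p • contactPoint γ (x • w + w') - q • contactPoint γ (x • -w + -w') = c) (s : ℝ) :
    (p / q) • γ s + -(q⁻¹ • c) ∈ Set.range γ := by
  refine h.homothety_mem_range hw (hc.mono fun x hx => ?_) s
  rw [← hx, smul_sub, inv_smul_smul₀ hq, smul_smul, inv_mul_eq_div, neg_sub,
    add_sub_cancel]
  exact h.contactPoint_mem_range (smul_add_ne_zero (planeDet_neg_ne_zero hw) x)

theorem hasCenterOfSymmetry_of_affine (h : IsAnalyticOval γ Ω) (hpq : p ≠ 0 ∨ q ≠ 0)
    (hw : planeDet w w' ≠ 0)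
    (haff : ∀ᶠ x in 𝓝 τ, twoSidedY γ p q (x • w + w') = α * x + β) :
    HasCenterOfSymmetry Ω := by
  have hneg := h.mul_neg_of_affine hpq hw haff
  have hp : p ≠ 0 := left_ne_zero_of_mul hneg.ne
  have hq : q ≠ 0 := right_ne_zero_of_mul hneg.ne
  obtain ⟨c, hc⟩ := h.eventually_contactPoint_sub_eq_of_affine hw haff
  have hpq' := h.homothety_mem_range_of_contactPoint_sub_eq hq hw hc
  have hqp' := h.homothety_mem_range_of_contactPoint_sub_eq (p := q) (q := p) (c := -c) (τ := τ)
    hp (planeDet_neg_ne_zero hw) (hc.mono fun x hx => by rw [neg_neg, neg_neg, ← hx, neg_sub])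
  have hle := h.abs_le_one_of_homothety hpq'
  have hge := h.abs_le_one_of_homothety hqp'
  rw [abs_div, div_le_one (abs_pos.2 hq)] at hle
  rw [abs_div, div_le_one (abs_pos.2 hp)] at hge
  have hratio : p / q = -1 := by
    rw [div_eq_iff hq, neg_one_mul]
    refine (abs_eq_abs.1 (hle.antisymm hge)).resolve_left fun he => ?_
    exact hneg.not_ge (he ▸ mul_self_nonneg q)
  refine h.hasCenterOfSymmetry_of_reflection (c := -(q⁻¹ • c)) fun s => ?_
  have := hpq' s
  rwa [hratio, neg_one_smul, neg_add_eq_sub] at this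

theorem twoSidedY_line_not_affine (h : IsAnalyticOval γ Ω) (hpq : p ≠ 0 ∨ q ≠ 0)
    (hsym : p = 0 ∨ q = 0 ∨ ¬ HasCenterOfSymmetry Ω) (hw : planeDet w w' ≠ 0) (τ α β : ℝ) :
    ¬ ∀ᶠ x in 𝓝 τ, twoSidedY γ p q (x • w + w') = α * x + β := by
  intro haff
  have hneg := h.mul_neg_of_affine hpq hw haff
  rcases hsym with hp | hq | hsym
  · exact left_ne_zero_of_mul hneg.ne hp
  · exact right_ne_zero_of_mul hneg.ne hq
  · exact hsym (h.hasCenterOfSymmetry_of_affine hpq hw haff)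

end Affine

end IsAnalyticOval

/-! ### Sums of translates of analytic functions -/

/-- `f` is given by a polynomial in a neighbourhood of `x`. -/
def IsPolynomialNear (f : ℝ → ℝ) (x : ℝ) : Prop :=
  ∃ P : Polynomial ℝ, f =ᶠ[𝓝 x] fun y => P.eval y

theorem isPolynomialNear_of_iteratedDeriv_eventuallyEq_zero {f : ℝ → ℝ} {x : ℝ} {n : ℕ}
    (hf : AnalyticAt ℝ f x) (h : iteratedDeriv n f =ᶠ[𝓝 x] 0) : IsPolynomialNear f x := by
  have hvanish : ∀ m, n ≤ m → iteratedDeriv m f x = 0 := by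
    intro m hm
    obtain ⟨k, rfl⟩ := Nat.exists_eq_add_of_le' hm
    rw [iteratedDeriv_eq_iterate, Function.iterate_add_apply, ← iteratedDeriv_eq_iterate,
      ← iteratedDeriv_eq_iterate, h.iteratedDeriv_eq k, iteratedDeriv_const_zero]
  refine ⟨∑ m ∈ Finset.range n, Polynomial.C (iteratedDeriv m f x / m.factorial) *
    (Polynomial.X - Polynomial.C x) ^ m, ?_⟩
  filter_upwards [hf.hasFPowerSeriesAt.eventually_hasSum_sub] with y hy
  have hfin := hasSum_sum_of_ne_finset_zero (L := .unconditional ℕ) (s := Finset.range n)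
    (f := fun m => FormalMultilinearSeries.ofScalars ℝ
      (fun m => iteratedDeriv m f x / m.factorial) m fun _ => y - x)
    fun m hm => by simp [hvanish m (by simpa using hm)]
  rw [hy.unique hfin, Polynomial.eval_finsetSum]
  simp [mul_comm]

theorem ae_iteratedDeriv_ne_zero {f : ℝ → ℝ} (hf : ∀ᵐ x, AnalyticAt ℝ f x)
    (hpoly : ∀ x, ¬ IsPolynomialNear f x) (n : ℕ) : ∀ᵐ x, iteratedDeriv n f x ≠ 0 := by
  have hnull : volume {x | AnalyticAt ℝ f x ∧ iteratedDeriv n f x = 0} = 0 := by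
    refine measure_null_of_locally_null _ fun x ⟨hx, _⟩ => ?_
    have hderiv := hx.iterated_deriv n
    rw [← iteratedDeriv_eq_iterate] at hderiv
    rcases hderiv.eventually_eq_zero_or_eventually_ne_zero with hzero | hne
    · exact (hpoly x (isPolynomialNear_of_iteratedDeriv_eventuallyEq_zero hx hzero)).elim
    · refine ⟨_, inter_mem_nhdsWithin _ (eventually_nhdsWithin_iff.1 hne),
        measure_mono_null (t := {x}) ?_ (measure_singleton x)⟩
      rintro y ⟨⟨-, hy⟩, hyx⟩
      by_contra hne
      exact hyx hne hy
  filter_upwards [hf, measure_eq_zero_iff_ae_notMem.1 hnull] with x hx hx' h0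
  exact hx' ⟨hx, h0⟩

theorem ae_notMem_of_ae_hasStrictDerivAt {f f' : ℝ → ℝ}
    (hf : ∀ᵐ s, HasStrictDerivAt f (f' s) s ∧ f' s ≠ 0) {N : Set ℝ} (hN : volume N = 0) :
    ∀ᵐ s, f s ∉ N := by
  set D := {s | HasStrictDerivAt f (f' s) s ∧ f' s ≠ 0}
  have hnull : volume (D ∩ f ⁻¹' N) = 0 := by
    refine measure_null_of_locally_null _ fun x ⟨hx, _⟩ => ?_
    let e := (hx.1.hasStrictFDerivAt_equiv hx.2).toOpenPartialHomeomorph f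
    have hxe : x ∈ e.source := HasStrictFDerivAt.mem_toOpenPartialHomeomorph_source _
    refine ⟨_, inter_mem_nhdsWithin _ (e.open_source.mem_nhds hxe), measure_mono_null ?_
      (addHaar_image_eq_zero_of_differentiableOn_of_addHaar_eq_zero volume
        (f := e.symm) (s := N ∩ f '' (D ∩ e.source)) ?_
        (measure_mono_null Set.inter_subset_left hN))⟩
    · rintro s ⟨⟨hs, hsN⟩, hse⟩
      exact ⟨f s, ⟨hsN, s, ⟨hs, hse⟩, rfl⟩, e.left_inv hse⟩
    · rintro _ ⟨-, s, ⟨hs, hse⟩, rfl⟩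
      refine (e.hasDerivAt_symm (f' := f' s) (e.map_source hse) hs.2
        ?_).differentiableAt.differentiableWithinAt
      exact (e.left_inv hse).symm ▸ hs.1.hasDerivAt
  filter_upwards [hf, measure_eq_zero_iff_ae_notMem.1 hnull] with s hs hs' hN
  exact hs' ⟨hs, hN⟩

section Translates

variable {ι : Type*} {S : Finset ι} {i₀ : ι} {φ : ι → ℝ → ℝ} {τ : ι → ℝ}

theorem ae_ae_analyticAt_translate {f : ℝ → ℝ} (hf : ∀ᵐ x, AnalyticAt ℝ f x) (c : ℝ) :
    ∀ᵐ x, ∀ᵐ l, AnalyticAt ℝ f (x + l * c) := by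
  refine (Measure.ae_ae_comm ?_).1 (ae_of_all _ fun l =>
    (measurePreserving_add_right volume (l * c)).quasiMeasurePreserving.ae hf)
  exact ((isOpen_analyticAt ℝ f).preimage
    (f := fun p : ℝ × ℝ => p.2 + p.1 * c) (by fun_prop)).measurableSet

theorem hasStrictDerivAt_sum_translate {x l : ℝ}
    (hφ : ∀ i ∈ S, AnalyticAt ℝ (φ i) (x + l * τ i)) :
    HasStrictDerivAt (fun l => ∑ i ∈ S, φ i (x + l * τ i))
      (∑ i ∈ S, τ i * deriv (φ i) (x + l * τ i)) l := by
  refine HasStrictDerivAt.fun_sum fun i hi => ?_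
  rw [mul_comm]
  have hline : HasStrictDerivAt (fun l => x + l * τ i) (τ i) l := by
    simpa using ((hasStrictDerivAt_id l).mul_const (τ i)).const_add x
  exact (hφ i hi).hasStrictDerivAt.comp l hline

/-- In the coordinates `(l, x)` with `x = s + l * τ a`, differentiating in `l` removes the
translate of index `a`. -/
theorem ae_ae_sum_insert_translate_ne_zero [DecidableEq ι] {a : ι}
    (hmeas : ∀ i ∈ insert a S, Measurable (φ i))
    (hφ : ∀ i ∈ insert a S, ∀ᵐ x, AnalyticAt ℝ (φ i) x) (ha : a ∉ S)
    (h : ∀ᵐ l, ∀ᵐ x, ∑ i ∈ S, (τ i - τ a) * deriv (φ i) (x + l * (τ i - τ a)) ≠ 0) :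
    ∀ᵐ l, ∀ᵐ s, ∑ i ∈ insert a S, φ i (s + l * τ i) ≠ 0 := by
  have hmeas_translate (i) (hi : i ∈ insert a S) :
      Measurable fun p : ℝ × ℝ => φ i (p.2 + p.1 * (τ i - τ a)) :=
    (hmeas i hi).comp (by fun_prop)
  have hderiv := (Measure.ae_ae_comm (measurableSet_eq_fun (Finset.measurable_fun_sum S
    fun i _ => ((measurable_deriv (φ i)).comp (g := deriv (φ i))
      (f := fun p : ℝ × ℝ => p.2 + p.1 * (τ i - τ a)) (by fun_prop)).const_mul (τ i - τ a))
    measurable_const).compl).1 h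
  have hanalytic : ∀ᵐ x, ∀ᵐ l, ∀ i ∈ insert a S, AnalyticAt ℝ (φ i) (x + l * (τ i - τ a)) := by
    have := (ae_ball_iff (insert a S).countable_toSet).2 fun i hi =>
      ae_ae_analyticAt_translate (hφ i hi) (τ i - τ a)
    filter_upwards [this] with x hx using (ae_ball_iff (insert a S).countable_toSet).2 hx
  have hsheared : ∀ᵐ x, ∀ᵐ l, ∑ i ∈ insert a S, φ i (x + l * (τ i - τ a)) ∉ ({0} : Set ℝ) := by
    filter_upwards [hderiv, hanalytic] with x hx hx'
    refine ae_notMem_of_ae_hasStrictDerivAt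
      (f' := fun l => ∑ i ∈ insert a S, (τ i - τ a) * deriv (φ i) (x + l * (τ i - τ a))) ?_
      (measure_singleton 0)
    filter_upwards [hx, hx'] with l hl hl'
    refine ⟨hasStrictDerivAt_sum_translate hl', ?_⟩
    rwa [Finset.sum_insert ha, sub_self, zero_mul, zero_add]
  have hsheared' := (Measure.ae_ae_comm (measurableSet_eq_fun
    (Finset.measurable_fun_sum (insert a S) hmeas_translate) measurable_const).compl).2 hsheared
  filter_upwards [hsheared'] with l hl
  filter_upwards [(measurePreserving_add_right volume (l * τ a)).quasiMeasurePreserving.ae hl]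
    with s hs
  have hshear (i) : s + l * τ a + l * (τ i - τ a) = s + l * τ i := by ring
  simpa only [hshear, Set.mem_singleton_iff] using hs

theorem ae_ae_sum_translate_ne_zero (hi₀ : i₀ ∈ S) (hmeas : ∀ i ∈ S, Measurable (φ i))
    (hφ : ∀ i ∈ S, ∀ᵐ x, AnalyticAt ℝ (φ i) x) (hτ : ∀ i ∈ S, i ≠ i₀ → τ i ≠ τ i₀)
    (hne : ∀ n, ∀ᵐ x, iteratedDeriv n (φ i₀) x ≠ 0) :
    ∀ᵐ l, ∀ᵐ s, ∑ i ∈ S, φ i (s + l * τ i) ≠ 0 := by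
  classical
  induction S using Finset.strongInduction generalizing φ τ with | H S ih => ?_
  by_cases hS : ∃ a ∈ S, a ≠ i₀
  · obtain ⟨a, ha, hai₀⟩ := hS
    rw [← Finset.insert_erase ha] at hmeas hφ ⊢
    have hsub := Finset.subset_insert a (S.erase a)
    refine ae_ae_sum_insert_translate_ne_zero hmeas hφ (Finset.notMem_erase a S) ?_
    refine ih _ (Finset.erase_ssubset ha) (φ := fun i => (τ i - τ a) • deriv (φ i))
      (τ := fun i => τ i - τ a) (Finset.mem_erase.2 ⟨hai₀.symm, hi₀⟩)
      (fun i _ => (measurable_deriv (φ i)).const_smul _)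
      (fun i hi => (hφ i (hsub hi)).mono fun x hx => hx.deriv.const_smul)
      (fun i hi hne => by simpa using hτ i (Finset.mem_of_mem_erase hi) hne) fun n => ?_
    filter_upwards [hne (n + 1)] with x hx
    rw [iteratedDeriv_succ'] at hx
    rw [iteratedDeriv_const_smul_field]
    exact smul_ne_zero (sub_ne_zero.2 (hτ a ha hai₀).symm) hx
  · push Not at hS
    obtain rfl : S = {i₀} := Finset.eq_singleton_iff_unique_mem.2 ⟨hi₀, hS⟩
    refine ae_of_all _ fun l => ?_
    simpa using (measurePreserving_add_right volume (l * τ i₀)).quasiMeasurePreserving.ae (hne 0)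

theorem ae_forall_null_ae_sum_translate_notMem (hi₀ : i₀ ∈ S)
    (hφ : ∀ i ∈ S, ∀ᵐ x, AnalyticAt ℝ (φ i) x) (hτ : ∀ i ∈ S, i ≠ i₀ → τ i ≠ τ i₀)
    (hpoly : ∀ x, ¬ IsPolynomialNear (φ i₀) x) :
    ∀ᵐ l, ∀ N : Set ℝ, volume N = 0 → ∀ᵐ s, ∑ i ∈ S, φ i (s + l * τ i) ∉ N := by
  filter_upwards [ae_ae_sum_translate_ne_zero hi₀ (fun i _ => measurable_deriv (φ i))
    (fun i hi => (hφ i hi).mono fun x hx => hx.deriv) hτ fun n => by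
      simpa only [iteratedDeriv_succ'] using ae_iteratedDeriv_ne_zero (hφ i₀ hi₀) hpoly (n + 1)]
    with l hl N hN
  have hanalytic : ∀ᵐ s, ∀ i ∈ S, AnalyticAt ℝ (φ i) (s + l * τ i) :=
    (ae_ball_iff S.countable_toSet).2 fun i hi =>
      (measurePreserving_add_right volume (l * τ i)).quasiMeasurePreserving.ae (hφ i hi)
  refine ae_notMem_of_ae_hasStrictDerivAt
    (f' := fun s => ∑ i ∈ S, deriv (φ i) (s + l * τ i)) ?_ hN
  filter_upwards [hl, hanalytic] with s hs hs'
  refine ⟨HasStrictDerivAt.fun_sum fun i hi => ?_, hs⟩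
  rw [← mul_one (deriv (φ i) _)]
  exact (hs' i hi).hasStrictDerivAt.comp s ((hasStrictDerivAt_id s).add_const (l * τ i))

end Translates

/-! ### Homogeneous functions which are polynomial on lines -/

theorem IsPolynomialNear.of_comp_affine {f : ℝ → ℝ} {c d x : ℝ} (hc : c ≠ 0)
    (h : IsPolynomialNear (fun y => f (c * y + d)) x) : IsPolynomialNear f (c * x + d) := by
  obtain ⟨P, hP⟩ := h
  refine ⟨P.comp (Polynomial.C c⁻¹ * (Polynomial.X - Polynomial.C d)), ?_⟩
  have hlim : Tendsto (fun y => c⁻¹ * (y - d)) (𝓝 (c * x + d)) (𝓝 x) := by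
    have : Continuous fun y => c⁻¹ * (y - d) := by fun_prop
    simpa [inv_mul_cancel_left₀ hc] using this.tendsto (c * x + d)
  filter_upwards [hlim.eventually hP] with y hy
  simpa [mul_inv_cancel_left₀ hc] using hy

theorem natDegree_le_one_of_eventually_eval_eq {P Q : Polynomial ℝ}
    (h : ∀ᶠ y in 𝓝 (1 : ℝ), P.eval y = y * Q.eval y⁻¹) : P.natDegree ≤ 1 := by
  have hreverse : Polynomial.X ^ Q.natDegree * P = Polynomial.X * Q.reverse := by
    refine Polynomial.eq_of_infinite_eval_eq _ _ (Set.Infinite.mono ?_ (infinite_of_mem_nhds 1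
      (h.and (eventually_ne_nhds one_ne_zero))))
    rintro y ⟨hy, hy0⟩
    let := invertibleOfNonzero (inv_ne_zero hy0)
    have hQ := Polynomial.eval₂_reverse_mul_pow (RingHom.id ℝ) y⁻¹ Q
    simp only [invOf_eq_inv, inv_inv, Polynomial.eval₂_id, inv_pow] at hQ
    simp only [Set.mem_ofPred_eq, Polynomial.eval_mul, Polynomial.eval_pow, Polynomial.eval_X]
    rw [hy, ← hQ]
    field_simp
  rcases eq_or_ne P 0 with rfl | hP
  · simp
  · have hdeg := congr_arg Polynomial.natDegree hreverse
    rw [Polynomial.natDegree_X_pow_mul _ hP] at hdeg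
    have hmul := Polynomial.natDegree_mul_le (p := Polynomial.X) (q := Q.reverse)
    have hQ := Polynomial.reverse_natDegree_le Q
    rw [Polynomial.natDegree_X] at hmul
    omega

theorem eq_smul_add_smul_of_planeDet_ne_zero {v w : Plane} (h : planeDet v w ≠ 0) (u : Plane) :
    u = (planeDet u w / planeDet v w) • v + (planeDet v u / planeDet v w) • w := by
  refine plane_ext ?_ ?_ <;> simp only [PiLp.add_apply, PiLp.smul_apply, smul_eq_mul] <;>
    field_simp <;> unfold planeDet <;> ring

section Homogeneous

variable {G : Plane → ℝ} {w w' v : Plane}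

/-- The points `v` off the line `ℝ w` at which `G` is polynomial in the direction `w`. -/
def polynomialLocus (G : Plane → ℝ) (w : Plane) : Set Plane :=
  {v | planeDet w v ≠ 0 ∧ IsPolynomialNear (fun t => G (t • w + v)) 0}

theorem isOpen_polynomialLocus (hG : ∀ ξ, ∀ c > 0, G (c • ξ) = c * G ξ) (w : Plane) :
    IsOpen (polynomialLocus G w) := by
  refine isOpen_iff_eventually.2 fun v ⟨hv, P, hP⟩ => ?_
  set a : Plane → ℝ := fun u => planeDet u v / planeDet w v with ha
  set b : Plane → ℝ := fun u => planeDet w u / planeDet w v with hb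
  have hac : Continuous a := by unfold a planeDet; fun_prop
  have hbc : Continuous b := by unfold b planeDet; fun_prop
  have hav : a v = 0 := by simp [ha, planeDet, mul_comm]
  have hbv : b v = 1 := div_self hv
  have hlim : Tendsto (fun u => a u / b u) (𝓝 v) (𝓝 0) := by
    have := hac.continuousAt.tendsto.div hbc.continuousAt.tendsto (hbv.trans_ne one_ne_zero)
    rwa [hav, zero_div] at this
  have hpos : ∀ᶠ u in 𝓝 v, 0 < b u :=
    hbc.continuousAt.eventually (lt_mem_nhds (hbv.symm ▸ one_pos))
  filter_upwards [hlim.eventually hP.eventually_nhds, hpos] with u hu hbu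
  refine ⟨fun h0 => hbu.ne' (by simp [hb, h0]),
    Polynomial.C (b u) * P.comp (Polynomial.C (b u)⁻¹ * (Polynomial.X + Polynomial.C (a u))), ?_⟩
  have hlim' : Tendsto (fun t => (b u)⁻¹ * (t + a u)) (𝓝 0) (𝓝 (a u / b u)) := by
    have : Continuous fun t => (b u)⁻¹ * (t + a u) := by fun_prop
    simpa [div_eq_inv_mul] using this.tendsto 0
  filter_upwards [hlim'.eventually hu] with t ht
  have hdecomp : t • w + u = b u • (((b u)⁻¹ * (t + a u)) • w + v) := by
    conv_lhs => rw [eq_smul_add_smul_of_planeDet_ne_zero hv u]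
    rw [smul_add, smul_smul, mul_inv_cancel_left₀ hbu.ne', add_smul, add_assoc]
  rw [hdecomp, hG _ _ hbu, ht]
  simp

/- On a line through `v = α w + β w'` both parametrizations are polynomial: by homogeneity the one
in the direction `w` is `P(y) = y Q(1 / y)`, where `Q` is the one in the direction `w'`. -/
theorem eventually_affine_of_mem_polynomialLocus (hG : ∀ ξ, ∀ c > 0, G (c • ξ) = c * G ξ)
    (hw : planeDet w w' ≠ 0) (hv : v ∈ polynomialLocus G w) (hv' : v ∈ polynomialLocus G w') :
    ∃ α β : ℝ, ∀ᶠ t in 𝓝 0, G (t • w + v) = α * t + β := by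
  obtain ⟨-, P, hP⟩ := hv
  obtain ⟨hwv', Q, hQ⟩ := hv'
  set a := planeDet v w' / planeDet w w'
  set b := planeDet w v / planeDet w w'
  have ha : a ≠ 0 := by
    refine div_ne_zero (fun h0 => hwv' ?_) hw
    rw [← neg_eq_zero, ← h0]
    unfold planeDet
    ring
  have hv : v = a • w + b • w' := eq_smul_add_smul_of_planeDet_ne_zero hw v
  have hlim : Tendsto (fun y : ℝ => a * (y - 1)) (𝓝 1) (𝓝 0) := by
    have : Continuous fun y : ℝ => a * (y - 1) := by fun_prop
    simpa using this.tendsto 1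
  have hlim' : Tendsto (fun y : ℝ => b * (y⁻¹ - 1)) (𝓝 1) (𝓝 0) := by
    simpa using ((tendsto_inv₀ (one_ne_zero (α := ℝ))).sub_const 1).const_mul b
  set P' := P.comp (Polynomial.C a * (Polynomial.X - 1))
  have hdeg : P'.natDegree ≤ 1 := by
    refine natDegree_le_one_of_eventually_eval_eq
      (Q := Q.comp (Polynomial.C b * (Polynomial.X - 1))) ?_
    filter_upwards [hlim.eventually hP, hlim'.eventually hQ, lt_mem_nhds one_pos]
      with y hPy hQy hy
    have hline : (a * (y - 1)) • w + v = y • ((b * (y⁻¹ - 1)) • w' + v) := by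
      rw [hv]
      match_scalars <;> field_simp <;> ring
    have := hG ((b * (y⁻¹ - 1)) • w' + v) y hy
    rw [← hline, hPy, hQy] at this
    simpa [P'] using this
  obtain ⟨α, β, hαβ⟩ := Polynomial.exists_eq_X_add_C_of_natDegree_le_one hdeg
  refine ⟨α * a⁻¹, α + β, ?_⟩
  filter_upwards [hP] with t ht
  have hP' : P'.eval (a⁻¹ * t + 1) = P.eval t := by simp [P', mul_inv_cancel_left₀ ha]
  rw [ht, ← hP', hαβ]
  simp only [Polynomial.eval_add, Polynomial.eval_mul, Polynomial.eval_C, Polynomial.eval_X]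
  ring

theorem exists_forall_not_isPolynomialNear (hG : ∀ ξ, ∀ c > 0, G (c • ξ) = c * G ξ)
    (haffine : ∀ w w', planeDet w w' ≠ 0 → ∀ τ α β : ℝ,
      ¬ ∀ᶠ x in 𝓝 τ, G (x • w + w') = α * x + β) :
    ∃ η : ℝ, ∀ c : ℝ, c ≠ 0 → ∀ w', planeDet !₂[1, η] w' ≠ 0 →
      ∀ x, ¬ IsPolynomialNear (fun x => G (x • c • !₂[1, η] + w')) x := by
  have hcountable : {η : ℝ | (polynomialLocus G !₂[1, η]).Nonempty}.Countable := by
    refine Set.PairwiseDisjoint.countable_of_isOpen (fun η _ η' _ hne => ?_)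
      (fun η _ => isOpen_polynomialLocus hG _) fun η hη => hη
    refine Set.disjoint_left.2 fun v hv hv' => ?_
    obtain ⟨α, β, h⟩ := eventually_affine_of_mem_polynomialLocus hG
      (by simpa [planeDet, sub_eq_zero] using hne.symm) hv hv'
    exact haffine _ _ hv.1 0 α β h
  obtain ⟨η, hη⟩ := (Set.ne_univ_iff_exists_notMem _).1 fun h =>
    Set.not_countable_univ (α := ℝ) (h ▸ hcountable)
  refine ⟨η, fun c hc w' hw' x hx => hη ⟨(c * x) • !₂[1, η] + w', ?_, ?_⟩⟩
  · simpa [planeDet, mul_add, mul_left_comm, mul_comm] using hw'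
  · rw [← add_neg_cancel (c * x)]
    refine IsPolynomialNear.of_comp_affine hc ?_
    simpa [← add_assoc, ← add_smul, smul_smul, mul_comm] using hx

end Homogeneous

/-! ### Lattices and integral coordinates -/

instance : PolishSpace SL2R :=
  haveI : PolishSpace (Matrix (Fin 2) (Fin 2) ℝ) :=
    inferInstanceAs (PolishSpace (Fin 2 → Fin 2 → ℝ))
  Matrix.SpecialLinearGroup.isClosedEmbedding_val.polishSpace

instance : MeasurableSpace SL2R := borel SL2R

instance : BorelSpace SL2R := ⟨rfl⟩

theorem mem_SL2Z_iff (g : SL2R) : g ∈ SL2Z ↔ ∀ i j, g.1 i j ∈ Set.range ((↑) : ℤ → ℝ) := by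
  constructor
  · rintro ⟨A, rfl⟩ i j
    exact ⟨A.1 i j, rfl⟩
  · intro h
    choose A hA using h
    have hg : (Matrix.of A).map (Int.castRingHom ℝ) = g.1 := by ext i j; exact hA i j
    have hdet : (Matrix.of A).det = 1 := by
      have h1 := g.2
      rw [← hg, ← RingHom.mapMatrix_apply, ← RingHom.map_det] at h1
      exact Int.cast_injective (h1.trans Int.cast_one.symm)
    exact ⟨⟨Matrix.of A, hdet⟩, Subtype.ext hg⟩

theorem continuous_entry (i j : Fin 2) : Continuous fun g : SL2R => g.1 i j :=
  Continuous.matrix_elem continuous_subtype_val i j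

instance : IsClosed (SL2Z : Set SL2R) := by
  have : (SL2Z : Set SL2R) = ⋂ i, ⋂ j, (fun g : SL2R => g.1 i j) ⁻¹' Set.range ((↑) : ℤ → ℝ) := by
    ext g
    simp only [SetLike.mem_coe, mem_SL2Z_iff, Set.mem_iInter, Set.mem_preimage]
  rw [this]
  exact isClosed_iInter fun i => isClosed_iInter fun j =>
    Int.isClosedEmbedding_coe_real.isClosed_range.preimage (continuous_entry i j)

theorem measurableSet_preimage_mk_iff {s : Set LatticeSpace} :
    MeasurableSet ((QuotientGroup.mk : SL2R → LatticeSpace) ⁻¹' s) ↔ MeasurableSet s :=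
  have hc : Continuous (QuotientGroup.mk : SL2R → LatticeSpace) := continuous_quot_mk
  hc.measurable.measurableSet_preimage_iff_of_surjective QuotientGroup.mk_surjective

/-- The vector with integral coordinates `n` in the basis of `ℝ²` given by the columns of `g`. -/
def matVec (g : SL2R) : ℤ × ℤ →+ Plane where
  toFun n := !₂[g.1 0 0 * n.1 + g.1 0 1 * n.2, g.1 1 0 * n.1 + g.1 1 1 * n.2]
  map_zero' := plane_ext (by simp) (by simp)
  map_add' m n := plane_ext (by simp; ring) (by simp; ring)

theorem matVec_apply_zero (g : SL2R) (n : ℤ × ℤ) :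
    matVec g n 0 = g.1 0 0 * n.1 + g.1 0 1 * n.2 := rfl

theorem matVec_apply_one (g : SL2R) (n : ℤ × ℤ) :
    matVec g n 1 = g.1 1 0 * n.1 + g.1 1 1 * n.2 := rfl

theorem continuous_matVec (n : ℤ × ℤ) : Continuous fun g : SL2R => matVec g n := by
  refine (PiLp.continuous_toLp 2 _).comp (continuous_pi fun i => ?_)
  fin_cases i
  · exact ((continuous_entry 0 0).mul_const _).add ((continuous_entry 0 1).mul_const _)
  · exact ((continuous_entry 1 0).mul_const _).add ((continuous_entry 1 1).mul_const _)

theorem mem_latticeVectors_iff {g : SL2R} {v : Plane} :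
    v ∈ latticeVectors (g : LatticeSpace) ↔ ∃ n : ℤ × ℤ, matVec g n = v := by
  constructor
  · rintro ⟨g', hg', n, rfl⟩
    obtain ⟨A, hA⟩ : g⁻¹ * g' ∈ SL2Z := QuotientGroup.eq.1 hg'.symm
    have hg : g' = g * (Matrix.SpecialLinearGroup.map (Int.castRingHom ℝ)) A := by
      rw [hA, mul_inv_cancel_left]
    refine ⟨(A.1 0 0 * n 0 + A.1 0 1 * n 1, A.1 1 0 * n 0 + A.1 1 1 * n 1), ?_⟩
    rw [hg]
    apply plane_ext <;>
      simp [matVec, Matrix.mul_apply, Matrix.mulVec, dotProduct, Fin.sum_univ_two] <;> ring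
  · rintro ⟨n, rfl⟩
    refine ⟨g, rfl, ![n.1, n.2], ?_⟩
    apply plane_ext <;> simp [matVec, Matrix.mulVec, dotProduct, Fin.sum_univ_two]

theorem matVec_mem_latticeVectors (g : SL2R) (n : ℤ × ℤ) :
    matVec g n ∈ latticeVectors (g : LatticeSpace) :=
  mem_latticeVectors_iff.2 ⟨n, rfl⟩

theorem planeDet_matVec (g : SL2R) (m n : ℤ × ℤ) :
    planeDet (matVec g m) (matVec g n) = (m.1 * n.2 - m.2 * n.1 : ℤ) := by
  have h := g.2
  rw [Matrix.det_fin_two] at h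
  simp only [planeDet, matVec_apply_zero, matVec_apply_one]
  push_cast
  linear_combination ((m.1 : ℝ) * n.2 - m.2 * n.1) * h

theorem matVec_injective (g : SL2R) : Function.Injective (matVec g) := by
  refine (injective_iff_map_eq_zero _).2 fun n hn => ?_
  have h1 := planeDet_matVec g (1, 0) n
  have h2 := planeDet_matVec g n (0, 1)
  simp only [hn, planeDet, PiLp.zero_apply, mul_zero, zero_mul, sub_zero, one_mul, mul_one] at h1 h2
  exact Prod.ext (by exact_mod_cast h2.symm) (by exact_mod_cast h1.symm)

theorem matVec_eq_zero_iff {g : SL2R} {n : ℤ × ℤ} : matVec g n = 0 ↔ n = 0 :=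
  map_eq_zero_iff _ (matVec_injective g)

theorem measurableSet_forall_latticeVectors {p : Plane → Plane → Prop}
    (hp : MeasurableSet {x : Plane × Plane | p x.1 x.2}) :
    MeasurableSet {L | ∀ v ∈ latticeVectors L, ∀ w ∈ latticeVectors L, p v w} := by
  rw [← measurableSet_preimage_mk_iff]
  have : (QuotientGroup.mk : SL2R → LatticeSpace) ⁻¹'
      {L | ∀ v ∈ latticeVectors L, ∀ w ∈ latticeVectors L, p v w} =
      ⋂ m, ⋂ n, {g | p (matVec g m) (matVec g n)} := by
    ext g
    simp only [mem_latticeVectors_iff, Set.mem_preimage, Set.mem_ofPred_eq, Set.mem_iInter,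
      forall_exists_index, forall_apply_eq_imp_iff]
  rw [this]
  exact MeasurableSet.iInter fun m => MeasurableSet.iInter fun n =>
    ((continuous_matVec m).prodMk (continuous_matVec n)).measurable hp

/-! ### Null sets of lattices and orbits of `SL₂(ℝ)` -/

section Invariant

variable {μ : Measure LatticeSpace} [SFinite μ] [SMulInvariantMeasure SL2R LatticeSpace μ]

theorem measure_eq_zero_of_ae_smul_notMem {T : Type*} [TopologicalSpace T] [MeasurableSpace T]
    [OpensMeasurableSpace T] {ν : Measure T} [SFinite ν] [NeZero ν] {a : T → SL2R}
    (ha : Continuous a) {B : Set LatticeSpace} (hB : MeasurableSet B)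
    (h : ∀ᵐ L ∂μ, ∀ᵐ t ∂ν, a t • L ∉ B) : μ B = 0 := by
  have hc : Continuous fun x : LatticeSpace × T => a x.2 • x.1 :=
    (ha.comp continuous_snd).smul continuous_fst
  have hswap : ∀ᵐ t ∂ν, ∀ᵐ L ∂μ, a t • L ∉ B :=
    (Measure.ae_ae_comm (p := fun L t => a t • L ∉ B) (hc.measurable hB.compl)).1 h
  obtain ⟨t, ht⟩ := hswap.exists
  rw [← measure_preimage_smul μ (a t) B]
  exact measure_eq_zero_iff_ae_notMem.2 ht

theorem ae_forall_latticeVectors {p : Plane → Plane → Prop}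
    (hp : MeasurableSet {x : Plane × Plane | p x.1 x.2}) {a : ℝ → SL2R} (ha : Continuous a)
    (h : ∀ (g : SL2R) m n, ∀ᵐ s : ℝ, p (matVec (a s * g) m) (matVec (a s * g) n)) :
    ∀ᵐ L ∂μ, ∀ v ∈ latticeVectors L, ∀ w ∈ latticeVectors L, p v w := by
  refine measure_eq_zero_of_ae_smul_notMem (ν := volume) ha
    (measurableSet_forall_latticeVectors hp).compl (Eventually.of_forall fun L => ?_)
  obtain ⟨g, rfl⟩ := QuotientGroup.mk_surjective L
  have hall : ∀ᵐ s : ℝ, ∀ m n, p (matVec (a s * g) m) (matVec (a s * g) n) := by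
    simpa only [ae_all_iff] using h g
  filter_upwards [hall] with s hs
  rw [Set.notMem_compl_iff]
  rintro _ hv _ hw
  obtain ⟨m, rfl⟩ := mem_latticeVectors_iff (g := a s * g).1 hv
  obtain ⟨n, rfl⟩ := mem_latticeVectors_iff (g := a s * g).1 hw
  exact hs m n

end Invariant

theorem matVec_mul (A g : SL2R) (n : ℤ × ℤ) :
    matVec (A * g) n = !₂[A.1 0 0 * matVec g n 0 + A.1 0 1 * matVec g n 1,
      A.1 1 0 * matVec g n 0 + A.1 1 1 * matVec g n 1] := by
  apply plane_ext <;>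
    simp [matVec, Matrix.SpecialLinearGroup.coe_mul, Matrix.mul_apply, Fin.sum_univ_two] <;> ring

/-- The unipotent matrix `(1 s; 0 1)`. -/
def upperUnipotent (s : ℝ) : SL2R := ⟨!![1, s; 0, 1], by simp⟩

/-- The unipotent matrix `(1 0; η 1)`. -/
def lowerUnipotent (η : ℝ) : SL2R := ⟨!![1, 0; η, 1], by simp⟩

/-- The diagonal matrix `diag(e^r, e^{-r})`. -/
def diagFlow (r : ℝ) : SL2R :=
  ⟨!![Real.exp r, 0; 0, Real.exp (-r)], by simp [Matrix.det_fin_two, ← Real.exp_add]⟩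

theorem continuous_upperUnipotent : Continuous upperUnipotent := by
  refine Continuous.subtype_mk (continuous_matrix fun i j => ?_) _
  fin_cases i <;> fin_cases j <;> first | exact continuous_const | exact continuous_id

theorem continuous_lowerUnipotent : Continuous lowerUnipotent := by
  refine Continuous.subtype_mk (continuous_matrix fun i j => ?_) _
  fin_cases i <;> fin_cases j <;> first | exact continuous_const | exact continuous_id

theorem continuous_diagFlow : Continuous diagFlow := by
  refine Continuous.subtype_mk (continuous_matrix fun i j => ?_) _
  fin_cases i <;> fin_cases j
  exacts [Real.continuous_exp, continuous_const, continuous_const,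
    Real.continuous_exp.comp continuous_neg]

theorem matVec_upperUnipotent_mul (s : ℝ) (g : SL2R) (n : ℤ × ℤ) :
    matVec (upperUnipotent s * g) n = !₂[matVec g n 0 + s * matVec g n 1, matVec g n 1] := by
  rw [matVec_mul]
  simp [upperUnipotent]

theorem matVec_lowerUnipotent_mul (η : ℝ) (g : SL2R) (n : ℤ × ℤ) :
    matVec (lowerUnipotent η * g) n = !₂[matVec g n 0, η * matVec g n 0 + matVec g n 1] := by
  rw [matVec_mul]
  simp [lowerUnipotent]

theorem matVec_diagFlow_mul (r : ℝ) (g : SL2R) (n : ℤ × ℤ) :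
    matVec (diagFlow r * g) n =
      !₂[Real.exp r * matVec g n 0, Real.exp (-r) * matVec g n 1] := by
  rw [matVec_mul]
  simp [diagFlow]

/-! ### Generic lattices -/

theorem ae_quadratic_ne_zero {a b c : ℝ} (h : a ≠ 0 ∨ b ≠ 0 ∨ c ≠ 0) :
    ∀ᵐ s : ℝ, a * s ^ 2 + b * s + c ≠ 0 := by
  set P : Polynomial ℝ := .C a * .X ^ 2 + .C b * .X + .C c with hP
  have hP0 : P ≠ 0 := by
    intro h0
    have hcoeff : ∀ n, P.coeff n = 0 := fun n => by rw [h0, Polynomial.coeff_zero]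
    rcases h with ha | hb | hc
    · exact ha (by simpa [hP, Polynomial.coeff_C] using hcoeff 2)
    · exact hb (by simpa [hP, Polynomial.coeff_C, Polynomial.coeff_X] using hcoeff 1)
    · exact hc (by simpa [hP, Polynomial.coeff_C] using hcoeff 0)
  filter_upwards [measure_eq_zero_iff_ae_notMem.1
    ((Polynomial.finite_setOfPred_isRoot hP0).measure_zero volume)] with s hs h0
  exact hs (by simpa [hP, Polynomial.IsRoot] using h0)

theorem ae_snd_ne_zero {μ : Measure LatticeSpace} [SFinite μ]
    [SMulInvariantMeasure SL2R LatticeSpace μ] :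
    ∀ᵐ L ∂μ, ∀ v ∈ latticeVectors L, v ≠ 0 → v 1 ≠ 0 := by
  have h := ae_forall_latticeVectors (μ := μ) (p := fun v _ => v ≠ 0 → v 1 ≠ 0)
    (by measurability) continuous_lowerUnipotent fun g m _ => ?_
  · exact h.mono fun L hL v hv => hL v hv v hv
  · rcases eq_or_ne m 0 with rfl | hm
    · exact Eventually.of_forall fun s h0 => absurd (map_zero _) h0
    · have hne : (0 : ℝ) ≠ 0 ∨ matVec g m 0 ≠ 0 ∨ matVec g m 1 ≠ 0 := by
        by_contra! hcon
        exact hm (matVec_eq_zero_iff.1 (plane_ext hcon.2.1 hcon.2.2))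
      filter_upwards [ae_quadratic_ne_zero hne] with s hs _
      simpa [matVec_lowerUnipotent_mul, mul_comm] using hs

/-- A lattice is generic if it has no nonzero vertical vector and if its vectors of the same
length are equal up to sign; its minimal pair is then unique. -/
def IsGenericLattice (L : LatticeSpace) : Prop :=
  ∀ v ∈ latticeVectors L, ∀ w ∈ latticeVectors L,
    (v ≠ 0 → v 0 ≠ 0) ∧ (‖v‖ = ‖w‖ → v = w ∨ v = -w)

theorem measurableSet_generic_pairs :
    MeasurableSet {x : Plane × Plane |
      (x.1 ≠ 0 → x.1 0 ≠ 0) ∧ (‖x.1‖ = ‖x.2‖ → x.1 = x.2 ∨ x.1 = -x.2)} := by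
  measurability

theorem measurableSet_isGenericLattice : MeasurableSet {L | IsGenericLattice L} :=
  measurableSet_forall_latticeVectors measurableSet_generic_pairs

theorem plane_norm_sq (v : Plane) : ‖v‖ ^ 2 = v 0 ^ 2 + v 1 ^ 2 := by
  rw [← real_inner_self_eq_norm_sq, plane_inner_eq, sq, sq]

theorem plane_eq_or_eq_neg {v w : Plane} (h0 : v 0 ^ 2 = w 0 ^ 2) (h1 : v 1 ^ 2 = w 1 ^ 2)
    (h01 : v 0 * v 1 = w 0 * w 1) : v = w ∨ v = -w := by
  by_cases hw : w 0 = 0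
  · have hv : v 0 = 0 := by simpa [hw] using h0
    exact (sq_eq_sq_iff_eq_or_eq_neg.1 h1).imp (plane_ext (hv.trans hw.symm))
      (plane_ext (by simp [hv, hw]))
  · refine (sq_eq_sq_iff_eq_or_eq_neg.1 h0).imp (fun h => plane_ext h ?_) fun h => plane_ext h ?_
    · exact mul_left_cancel₀ hw (h ▸ h01)
    · exact mul_left_cancel₀ hw (by simp only [h, PiLp.neg_apply] at h01 ⊢; linarith)

theorem ae_norm_matVec_upperUnipotent_eq (g : SL2R) (m n : ℤ × ℤ) :
    ∀ᵐ s : ℝ, ‖matVec (upperUnipotent s * g) m‖ = ‖matVec (upperUnipotent s * g) n‖ →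
      m = n ∨ m = -n := by
  by_cases hmn : m = n ∨ m = -n
  · exact Eventually.of_forall fun _ _ => hmn
  set v := matVec g m with hv
  set w := matVec g n with hw
  have hne : v 1 ^ 2 - w 1 ^ 2 ≠ 0 ∨ 2 * (v 0 * v 1 - w 0 * w 1) ≠ 0 ∨
      v 0 ^ 2 + v 1 ^ 2 - w 0 ^ 2 - w 1 ^ 2 ≠ 0 := by
    by_contra! hcon
    obtain ⟨h1, h01, h0⟩ := hcon
    refine hmn ((plane_eq_or_eq_neg (v := v) (w := w) (by linarith) (by linarith)
      (by linarith)).imp (fun h => matVec_injective g h) fun h => matVec_injective g ?_)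
    rw [map_neg]
    exact h
  filter_upwards [ae_quadratic_ne_zero hne] with s hs hnorm
  have hsq := congrArg (· ^ 2) hnorm
  simp only [plane_norm_sq, matVec_upperUnipotent_mul, ← hv, ← hw,
    Matrix.cons_val_zero, Matrix.cons_val_one] at hsq
  exact absurd (by linear_combination hsq) hs

theorem ae_isGenericLattice {μ : Measure LatticeSpace} [SFinite μ]
    [SMulInvariantMeasure SL2R LatticeSpace μ] : ∀ᵐ L ∂μ, IsGenericLattice L := by
  refine ae_forall_latticeVectors measurableSet_generic_pairs continuous_upperUnipotent
    fun g m n => Filter.Eventually.and ?_ ?_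
  · rcases eq_or_ne m 0 with rfl | hm
    · exact Eventually.of_forall fun s h0 => absurd (map_zero _) h0
    · have hne : (0 : ℝ) ≠ 0 ∨ matVec g m 1 ≠ 0 ∨ matVec g m 0 ≠ 0 := by
        by_contra! hcon
        exact hm (matVec_eq_zero_iff.1 (plane_ext hcon.2.2 hcon.2.1))
      filter_upwards [ae_quadratic_ne_zero hne] with s hs _
      simpa [matVec_upperUnipotent_mul, mul_comm, add_comm] using hs
  · filter_upwards [ae_norm_matVec_upperUnipotent_eq g m n] with s hs hnorm
    exact (hs hnorm).imp (fun h => by rw [h]) fun h => by rw [h, map_neg]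

/-! ### The minimal pair of a lattice -/

theorem linearIndependent_pair_iff_planeDet {v : Fin 2 → Plane} :
    LinearIndependent ℝ v ↔ planeDet (v 0) (v 1) ≠ 0 := by
  have hdet : planeDet (v 0) (v 1) = (Matrix.of fun i => (v i).ofLp).det := by
    rw [Matrix.det_fin_two]
    rfl
  rw [hdet, ← isUnit_iff_ne_zero, ← Matrix.isUnit_iff_isUnit_det,
    ← Matrix.linearIndependent_rows_iff_isUnit]
  exact (LinearMap.linearIndependent_iff (WithLp.linearEquiv 2 ℝ (Fin 2 → ℝ)).toLinearMap
    (LinearEquiv.ker _)).symm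

theorem abs_planeDet_le (v w : Plane) : |planeDet v w| ≤ ‖v‖ * ‖w‖ := by
  refine abs_le_of_sq_le_sq ?_ (by positivity)
  rw [mul_pow, plane_norm_sq, plane_norm_sq, planeDet]
  nlinarith [sq_nonneg (v 0 * w 0 + v 1 * w 1)]

theorem finite_latticeVectors_inter_closedBall (L : LatticeSpace) (r : ℝ) :
    {v ∈ latticeVectors L | ‖v‖ ≤ r}.Finite := by
  obtain ⟨g, rfl⟩ := QuotientGroup.mk_surjective L
  set M : ℤ := ⌈r * ‖matVec g (0, 1)‖⌉
  set M' : ℤ := ⌈‖matVec g (1, 0)‖ * r⌉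
  refine (((Set.finite_Icc (-M) M).prod (Set.finite_Icc (-M') M')).image (matVec g)).subset ?_
  rintro _ ⟨hv, hr⟩
  obtain ⟨n, rfl⟩ := mem_latticeVectors_iff.1 hv
  have h1 := abs_planeDet_le (matVec g n) (matVec g (0, 1))
  have h2 := abs_planeDet_le (matVec g (1, 0)) (matVec g n)
  simp only [planeDet_matVec, mul_one, mul_zero, sub_zero, one_mul, zero_mul] at h1 h2
  have hn1 : |(n.1 : ℝ)| ≤ M := (h1.trans (by gcongr)).trans (Int.le_ceil _)
  have hn2 : |(n.2 : ℝ)| ≤ M' := (h2.trans (by gcongr)).trans (Int.le_ceil _)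
  exact ⟨n, ⟨abs_le.1 (by exact_mod_cast hn1), abs_le.1 (by exact_mod_cast hn2)⟩, rfl⟩

theorem exists_forall_norm_le_of_subset_latticeVectors {L : LatticeSpace} {s : Set Plane}
    (hs : s ⊆ latticeVectors L) (hne : s.Nonempty) : ∃ v ∈ s, ∀ w ∈ s, ‖v‖ ≤ ‖w‖ := by
  obtain ⟨v₀, hv₀⟩ := hne
  have hfin : {v ∈ s | ‖v‖ ≤ ‖v₀‖}.Finite :=
    (finite_latticeVectors_inter_closedBall L ‖v₀‖).subset fun v hv => ⟨hs hv.1, hv.2⟩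
  obtain ⟨v, hv, hmin⟩ := Set.exists_min_image _ norm hfin ⟨v₀, hv₀, le_rfl⟩
  refine ⟨v, hv.1, fun w hw => ?_⟩
  rcases le_total ‖w‖ ‖v₀‖ with h | h
  · exact hmin w ⟨hw, h⟩
  · exact (hmin v₀ ⟨hv₀, le_rfl⟩).trans h

/-- A reduced pair of vectors of `L`, obtained greedily: `v` is a shortest nonzero vector of `L`,
and `w` is a shortest vector of `L` which is not proportional to `v`. -/
structure IsReducedPair (L : LatticeSpace) (v w : Plane) : Prop where
  fst_mem : v ∈ latticeVectors L
  snd_mem : w ∈ latticeVectors L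
  planeDet_ne_zero : planeDet v w ≠ 0
  fst_le : ∀ x ∈ latticeVectors L, x ≠ 0 → ‖v‖ ≤ ‖x‖
  snd_le : ∀ x ∈ latticeVectors L, planeDet v x ≠ 0 → ‖w‖ ≤ ‖x‖

theorem neg_mem_latticeVectors {L : LatticeSpace} {v : Plane} (hv : v ∈ latticeVectors L) :
    -v ∈ latticeVectors L := by
  obtain ⟨g, rfl⟩ := QuotientGroup.mk_surjective L
  obtain ⟨n, rfl⟩ := mem_latticeVectors_iff.1 hv
  exact mem_latticeVectors_iff.2 ⟨-n, map_neg _ n⟩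

theorem planeDet_neg_right (v w : Plane) : planeDet v (-w) = -planeDet v w := by
  simp only [planeDet, PiLp.neg_apply]
  ring

theorem exists_mem_latticeVectors_planeDet_ne_zero (L : LatticeSpace) {v : Plane} (hv : v ≠ 0) :
    ∃ w ∈ latticeVectors L, planeDet v w ≠ 0 := by
  obtain ⟨g, rfl⟩ := QuotientGroup.mk_surjective L
  by_contra! hcon
  have h1 := hcon _ (matVec_mem_latticeVectors g (1, 0))
  have h2 := hcon _ (matVec_mem_latticeVectors g (0, 1))
  have hdet := planeDet_matVec g (1, 0) (0, 1)
  simp only [planeDet] at h1 h2 hdet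
  refine hv (plane_ext ?_ ?_)
  · push_cast at hdet
    simp only [PiLp.zero_apply]
    linear_combination matVec g (1, 0) 0 * h2 - matVec g (0, 1) 0 * h1 - v 0 * hdet
  · push_cast at hdet
    simp only [PiLp.zero_apply]
    linear_combination matVec g (1, 0) 1 * h2 - matVec g (0, 1) 1 * h1 - v 1 * hdet

theorem exists_isReducedPair {L : LatticeSpace} (hL : ∀ v ∈ latticeVectors L, v ≠ 0 → v 0 ≠ 0) :
    ∃ v w, IsReducedPair L v w ∧ 0 < v 0 ∧ 0 < w 0 := by
  have hsign : ∀ x ∈ latticeVectors L, x ≠ 0 → 0 < x 0 ∨ 0 < (-x) 0 := fun x hx hx0 =>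
    (hL x hx hx0).lt_or_gt.symm.imp_right fun h => by simpa using h
  obtain ⟨x, hx, hx0⟩ := exists_mem_latticeVectors_planeDet_ne_zero L (v := !₂[1, 0])
    fun h => by simpa using congrArg (· 0) h
  have hx0 : x ≠ 0 := by rintro rfl; simp [planeDet] at hx0
  obtain ⟨v, ⟨hv, hv0⟩, hvmin⟩ := exists_forall_norm_le_of_subset_latticeVectors
    (s := {x ∈ latticeVectors L | 0 < x 0}) (Set.sep_subset _ _)
    ((hsign x hx hx0).elim (fun h => ⟨x, hx, h⟩) fun h => ⟨-x, neg_mem_latticeVectors hx, h⟩)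
  obtain ⟨y, hy, hvy⟩ := exists_mem_latticeVectors_planeDet_ne_zero L (v := v)
    (by rintro rfl; simp at hv0)
  have hdet : ∀ x, planeDet v x ≠ 0 → x ≠ 0 := by rintro _ h rfl; simp [planeDet] at h
  obtain ⟨w, ⟨hw, hw0, hvw⟩, hwmin⟩ := exists_forall_norm_le_of_subset_latticeVectors
    (s := {x ∈ latticeVectors L | 0 < x 0 ∧ planeDet v x ≠ 0}) (Set.sep_subset _ _)
    ((hsign y hy (hdet y hvy)).elim (fun h => ⟨y, hy, h, hvy⟩) fun h =>
      ⟨-y, neg_mem_latticeVectors hy, h, by rwa [planeDet_neg_right, neg_ne_zero]⟩)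
  refine ⟨v, w, ⟨hv, hw, hvw, fun x hx hx0 => ?_, fun x hx hvx => ?_⟩, hv0, hw0⟩
  · rcases hsign x hx hx0 with h | h
    · exact hvmin x ⟨hx, h⟩
    · exact norm_neg x ▸ hvmin (-x) ⟨neg_mem_latticeVectors hx, h⟩
  · rcases hsign x hx (hdet x hvx) with h | h
    · exact hwmin x ⟨hx, h, hvx⟩
    · exact norm_neg x ▸ hwmin (-x) ⟨neg_mem_latticeVectors hx, h,
        by rwa [planeDet_neg_right, neg_ne_zero]⟩

namespace IsReducedPair

variable {L : LatticeSpace} {v w : Plane}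

theorem fst_ne_zero (h : IsReducedPair L v w) : v ≠ 0 := by
  rintro rfl
  simpa [planeDet] using h.planeDet_ne_zero

theorem snd_ne_zero (h : IsReducedPair L v w) : w ≠ 0 := by
  rintro rfl
  simpa [planeDet] using h.planeDet_ne_zero

theorem successiveMin_one (h : IsReducedPair L v w) : successiveMin 1 L = ‖v‖ := by
  refine IsLeast.csInf_eq ⟨⟨norm_pos_iff.2 h.fst_ne_zero, fun _ => v, fun _ => ⟨h.fst_mem, le_rfl⟩,
    linearIndependent_unique_iff.2 h.fst_ne_zero⟩, ?_⟩
  rintro r ⟨-, x, hx, hli⟩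
  exact (h.fst_le _ (hx 0).1 (hli.ne_zero 0)).trans (hx 0).2

theorem successiveMin_two (h : IsReducedPair L v w) : successiveMin 2 L = ‖w‖ := by
  refine IsLeast.csInf_eq ⟨⟨norm_pos_iff.2 h.snd_ne_zero, ![v, w], ?_,
    linearIndependent_pair_iff_planeDet.2 h.planeDet_ne_zero⟩, ?_⟩
  · exact Fin.forall_fin_two.2 ⟨⟨h.fst_mem, h.fst_le w h.snd_mem h.snd_ne_zero⟩,
      ⟨h.snd_mem, le_rfl⟩⟩
  rintro r ⟨-, x, hx, hli⟩
  obtain ⟨j, hj⟩ : ∃ j, planeDet v (x j) ≠ 0 := by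
    by_contra! hcon
    have hdet := linearIndependent_pair_iff_planeDet.1 hli
    have h0 := hcon 0
    have h1 := hcon 1
    simp only [planeDet] at hdet h0 h1
    refine h.fst_ne_zero (plane_ext (mul_right_cancel₀ hdet ?_) (mul_right_cancel₀ hdet ?_)) <;>
      simp only [PiLp.zero_apply, zero_mul]
    · linear_combination x 0 0 * h1 - x 1 0 * h0
    · linear_combination x 0 1 * h1 - x 1 1 * h0
  exact (h.snd_le _ (hx j).1 hj).trans (hx j).2

theorem isMinimalPair (h : IsReducedPair L v w) (hv : 0 < v 0) (hw : 0 < w 0) :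
    IsMinimalPair L (v, w) :=
  ⟨h.fst_mem, h.snd_mem, hv, hw, h.successiveMin_one.symm, h.successiveMin_two.symm⟩

end IsReducedPair

theorem IsGenericLattice.eq_of_isMinimalPair {L : LatticeSpace} (hL : IsGenericLattice L)
    {e e' : Plane × Plane} (he : IsMinimalPair L e) (he' : IsMinimalPair L e') : e = e' := by
  have key : ∀ v ∈ latticeVectors L, ∀ w ∈ latticeVectors L, 0 < v 0 → 0 < w 0 → ‖v‖ = ‖w‖ →
      v = w := by
    intro v hv w hw hv0 hw0 hvw
    refine ((hL v hv w hw).2 hvw).resolve_right ?_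
    rintro rfl
    exact lt_asymm hw0 (by simpa using hv0)
  obtain ⟨hv, hw, hv0, hw0, hv1, hw2⟩ := he
  obtain ⟨hv', hw', hv0', hw0', hv1', hw2'⟩ := he'
  exact Prod.ext (key _ hv _ hv' hv0 hv0' (hv1.trans hv1'.symm))
    (key _ hw _ hw' hw0 hw0' (hw2.trans hw2'.symm))

theorem IsGenericLattice.minimalPair_eq_iff {L : LatticeSpace} (hL : IsGenericLattice L)
    {v w : Plane} : minimalPair L = (v, w) ↔ IsReducedPair L v w ∧ 0 < v 0 ∧ 0 < w 0 := by
  have of_reduced : ∀ {x y}, IsReducedPair L x y → 0 < x 0 → 0 < y 0 → minimalPair L = (x, y) :=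
    fun h hx hy => hL.eq_of_isMinimalPair
      (Classical.epsilon_spec ⟨_, h.isMinimalPair hx hy⟩) (h.isMinimalPair hx hy)
  refine ⟨fun heq => ?_, fun ⟨h, hv, hw⟩ => of_reduced h hv hw⟩
  obtain ⟨x, y, h, hx, hy⟩ := exists_isReducedPair fun v hv => (hL v hv v hv).1
  obtain ⟨rfl, rfl⟩ := Prod.mk.inj (heq.symm.trans (of_reduced h hx hy))
  exact ⟨h, hx, hy⟩

theorem IsGenericLattice.exists_minimalPair_eq {g : SL2R}
    (hL : IsGenericLattice (g : LatticeSpace)) : ∃ m n : ℤ × ℤ,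
      minimalPair (g : LatticeSpace) = (matVec g m, matVec g n) ∧ m.1 * n.2 - m.2 * n.1 ≠ 0 := by
  have hred := (hL.minimalPair_eq_iff.1 (Prod.mk.eta (p := minimalPair _)).symm).1
  obtain ⟨m, hm⟩ := mem_latticeVectors_iff.1 hred.fst_mem
  obtain ⟨n, hn⟩ := mem_latticeVectors_iff.1 hred.snd_mem
  have hdet := hred.planeDet_ne_zero
  rw [← hm, ← hn, planeDet_matVec] at hdet
  exact ⟨m, n, by rw [hm, hn], Int.cast_ne_zero.1 hdet⟩

theorem measurableSet_isReducedPair (m n : ℤ × ℤ) :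
    MeasurableSet {g : SL2R | IsReducedPair (g : LatticeSpace) (matVec g m) (matVec g n)} := by
  have heq : {g : SL2R | IsReducedPair (g : LatticeSpace) (matVec g m) (matVec g n)} =
      {_g | m.1 * n.2 - m.2 * n.1 ≠ 0} ∩
        ((⋂ (x : ℤ × ℤ) (_ : x ≠ 0), {g | ‖matVec g m‖ ≤ ‖matVec g x‖}) ∩
          ⋂ (x : ℤ × ℤ) (_ : m.1 * x.2 - m.2 * x.1 ≠ 0), {g | ‖matVec g n‖ ≤ ‖matVec g x‖}) := by
    ext g
    simp only [Set.mem_inter_iff, Set.mem_iInter, Set.mem_ofPred_eq]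
    refine ⟨fun h => ⟨?_, fun x hx => ?_, fun x hx => ?_⟩,
      fun ⟨hmn, h1, h2⟩ => ⟨?_, ?_, ?_, ?_, ?_⟩⟩
    · exact Int.cast_ne_zero.1 (planeDet_matVec g m n ▸ h.planeDet_ne_zero)
    · exact h.fst_le _ (matVec_mem_latticeVectors g x) (matVec_eq_zero_iff.not.2 hx)
    · exact h.snd_le _ (matVec_mem_latticeVectors g x) (by rwa [planeDet_matVec, Int.cast_ne_zero])
    · exact matVec_mem_latticeVectors g m
    · exact matVec_mem_latticeVectors g n
    · rwa [planeDet_matVec, Int.cast_ne_zero]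
    · rintro _ hx hx0
      obtain ⟨x, rfl⟩ := mem_latticeVectors_iff.1 hx
      exact h1 x (matVec_eq_zero_iff.not.1 hx0)
    · rintro _ hx hx0
      obtain ⟨x, rfl⟩ := mem_latticeVectors_iff.1 hx
      exact h2 x (by rwa [planeDet_matVec, Int.cast_ne_zero] at hx0)
  have hle : ∀ x y, MeasurableSet {g : SL2R | ‖matVec g x‖ ≤ ‖matVec g y‖} := fun x y =>
    (isClosed_le (continuous_matVec x).norm (continuous_matVec y).norm).measurableSet
  rw [heq]
  exact (MeasurableSet.const _).inter
    ((MeasurableSet.iInter fun x => .iInter fun _ => hle m x).inter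
      (MeasurableSet.iInter fun x => .iInter fun _ => hle n x))

theorem measurableSet_isGenericLattice_and_minimalPair_mem {U : Set (Plane × Plane)}
    (hU : MeasurableSet U) : MeasurableSet {L | IsGenericLattice L ∧ minimalPair L ∈ U} := by
  rw [← measurableSet_preimage_mk_iff]
  have heq : (QuotientGroup.mk : SL2R → LatticeSpace) ⁻¹'
      {L | IsGenericLattice L ∧ minimalPair L ∈ U} =
      (QuotientGroup.mk ⁻¹' {L | IsGenericLattice L}) ∩ ⋃ (m : ℤ × ℤ) (n : ℤ × ℤ),
        {g | IsReducedPair (g : LatticeSpace) (matVec g m) (matVec g n)} ∩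
          {g | 0 < matVec g m 0} ∩ {g | 0 < matVec g n 0} ∩
          {g | (matVec g m, matVec g n) ∈ U} := by
    ext g
    simp only [Set.mem_preimage, Set.mem_ofPred_eq, Set.mem_inter_iff, Set.mem_iUnion]
    refine and_congr_right fun hg => ⟨fun hmem => ?_, ?_⟩
    · obtain ⟨m, n, hmn, -⟩ := hg.exists_minimalPair_eq
      obtain ⟨hred, hm, hn⟩ := hg.minimalPair_eq_iff.1 hmn
      exact ⟨m, n, ⟨⟨hred, hm⟩, hn⟩, hmn ▸ hmem⟩
    · rintro ⟨m, n, ⟨⟨hred, hm⟩, hn⟩, hmem⟩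
      rwa [hg.minimalPair_eq_iff.2 ⟨hred, hm, hn⟩]
  have hpos : ∀ m, MeasurableSet {g : SL2R | 0 < matVec g m 0} := fun m =>
    (isOpen_lt continuous_const
      ((PiLp.continuous_apply 2 _ 0).comp (continuous_matVec m))).measurableSet
  rw [heq]
  exact (measurableSet_preimage_mk_iff.2 measurableSet_isGenericLattice).inter <|
    .iUnion fun m => .iUnion fun n =>
      (((measurableSet_isReducedPair m n).inter (hpos m)).inter (hpos n)).inter
        (((continuous_matVec m).prodMk (continuous_matVec n)).measurable hU)

theorem aemeasurable_minimalPair {μ : Measure LatticeSpace} [SFinite μ]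
    [SMulInvariantMeasure SL2R LatticeSpace μ] : AEMeasurable minimalPair μ := by
  refine ⟨{L | IsGenericLattice L}.indicator minimalPair, fun U hU => ?_,
    ae_isGenericLattice.mono fun L hL => (Set.indicator_of_mem (s := {L | _}) hL _).symm⟩
  rw [Set.indicator_preimage, Set.ite, Set.inter_comm]
  exact (measurableSet_isGenericLattice_and_minimalPair_mem hU).union
    ((measurable_const hU).diff measurableSet_isGenericLattice)

/-! ### Absolute continuity of the laws of linear combinations -/

theorem PrimeIndex.ne_zero {k : ℤ × ℤ} (hk : k ∈ PrimeIndex) : k ≠ 0 :=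
  fun h0 => zero_ne_one ((congrArg Prod.snd h0).symm.trans (hk.2.2 (congrArg Prod.fst h0)))

theorem PrimeIndex.eq_of_det_eq_zero {k k' : ℤ × ℤ} (hk : k ∈ PrimeIndex) (hk' : k' ∈ PrimeIndex)
    (h : k.1 * k'.2 - k.2 * k'.1 = 0) : k = k' := by
  obtain ⟨hc, h0, h1⟩ := hk
  obtain ⟨hc', h0', h1'⟩ := hk'
  have hdvd : k.1 ∣ k'.1 := hc.dvd_of_dvd_mul_left ⟨k'.2, by linarith⟩
  have hdvd' : k'.1 ∣ k.1 := hc'.dvd_of_dvd_mul_right ⟨k.2, by linarith⟩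
  have hfst : k.1 = k'.1 := Int.dvd_antisymm h0 h0' hdvd hdvd'
  by_cases hz : k.1 = 0
  · exact Prod.ext hfst (by rw [h1 hz, h1' (hfst ▸ hz)])
  · refine Prod.ext hfst (mul_left_cancel₀ hz ?_)
    rw [← hfst] at h
    linarith

theorem zsmul_add_zsmul_ne_zero {m n k : ℤ × ℤ} (hmn : m.1 * n.2 - m.2 * n.1 ≠ 0) (hk : k ≠ 0) :
    k.1 • m + k.2 • n ≠ 0 := by
  intro h
  have hfst : k.1 * m.1 + k.2 * n.1 = 0 := congrArg Prod.fst h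
  have hsnd : k.1 * m.2 + k.2 * n.2 = 0 := congrArg Prod.snd h
  refine hk (Prod.ext ((mul_eq_zero.1 ?_).resolve_right hmn)
    ((mul_eq_zero.1 ?_).resolve_right hmn))
  · linear_combination n.2 * hfst - n.1 * hsnd
  · linear_combination m.1 * hsnd - m.2 * hfst

theorem latticeVec_mk {g : SL2R} {m n : ℤ × ℤ}
    (hmn : minimalPair (g : LatticeSpace) = (matVec g m, matVec g n)) (k : ℤ × ℤ) :
    latticeVec k (g : LatticeSpace) = matVec g (k.1 • m + k.2 • n) := by
  rw [latticeVec, hmn, map_add, map_zsmul, map_zsmul, Int.cast_smul_eq_zsmul,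
    Int.cast_smul_eq_zsmul]

/-- The two-parameter family in `SL₂(ℝ)` whose orbits move every lattice vector, up to positive
factors, along a line of direction `(1, η)`: `t.1` rescales the offsets of the vectors on these
lines, and `t.2` translates all of them simultaneously. -/
def slantedFlow (η : ℝ) (t : ℝ × ℝ) : SL2R :=
  lowerUnipotent η * (upperUnipotent t.2 * diagFlow t.1)

theorem continuous_slantedFlow (η : ℝ) : Continuous (slantedFlow η) :=
  continuous_const.mul ((continuous_upperUnipotent.comp continuous_snd).mul
    (continuous_diagFlow.comp continuous_fst))

theorem matVec_slantedFlow_mul (η r s : ℝ) {g : SL2R} {n : ℤ × ℤ} (hn : matVec g n 1 ≠ 0) :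
    matVec (slantedFlow η (r, s) * g) n =
      Real.exp (-r) • ((s + Real.exp (2 * r) * (matVec g n 0 / matVec g n 1)) •
        matVec g n 1 • !₂[1, η] + matVec g n 1 • !₂[0, 1]) := by
  have hexp : Real.exp r = Real.exp (-r) * Real.exp (2 * r) := by
    rw [← Real.exp_add]
    congr 1
    ring
  rw [slantedFlow, mul_assoc, mul_assoc, matVec_lowerUnipotent_mul, matVec_upperUnipotent_mul,
    matVec_diagFlow_mul, hexp]
  refine plane_ext ?_ ?_ <;>
    simp only [PiLp.add_apply, PiLp.smul_apply, smul_eq_mul, Matrix.cons_val_zero,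
      Matrix.cons_val_one, mul_one, mul_zero, add_zero] <;>
    field_simp <;> ring

section Invariant

variable {μ : Measure LatticeSpace} [SFinite μ] [SMulInvariantMeasure SL2R LatticeSpace μ]

theorem aemeasurable_latticeVec (k : ℤ × ℤ) : AEMeasurable (latticeVec k) μ :=
  (show Measurable fun e : Plane × Plane => (k.1 : ℝ) • e.1 + (k.2 : ℝ) • e.2 by
    fun_prop).comp_aemeasurable aemeasurable_minimalPair

theorem ae_notMem_of_ae_smul_notMem {Y : Type*} [MeasurableSpace Y] {F : LatticeSpace → Y}
    (hF : AEMeasurable F μ) {N : Set Y} (hN : MeasurableSet N) {a : ℝ × ℝ → SL2R}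
    (ha : Continuous a)
    (h : ∀ᵐ L ∂μ, ∀ᵐ r, ∀ᵐ s, IsGenericLattice (a (r, s) • L) → F (a (r, s) • L) ∉ N) :
    ∀ᵐ L ∂μ, F L ∉ N := by
  obtain ⟨B, hBsub, hB, hBae⟩ := (hF.nullMeasurable hN).exists_measurable_subset_ae_eq
  have hB' : MeasurableSet (B ∩ {L | IsGenericLattice L}) :=
    hB.inter measurableSet_isGenericLattice
  have hnull : μ (B ∩ {L | IsGenericLattice L}) = 0 := by
    refine measure_eq_zero_of_ae_smul_notMem (ν := volume) ha hB' (h.mono fun L hL => ?_)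
    refine (Measure.ae_prod_iff_ae_ae ?_).2 ?_
    · exact (ha.smul continuous_const).measurable hB'.compl
    · exact hL.mono fun r hr => hr.mono fun s hs hmem => hs hmem.2 (hBsub hmem.1)
  filter_upwards [measure_eq_zero_iff_ae_notMem.1 hnull, hBae.mem_iff, ae_isGenericLattice (μ := μ)]
    with L hL hLB hgen hLN
  exact hL ⟨hLB.2 hLN, hgen⟩

variable {ι : Type*} {S : Finset ι} {i₀ : ι} {Φ : ι → Plane → ℝ}

theorem ae_sum_slantedFlow_notMem (hi₀ : i₀ ∈ S)
    (hsmul : ∀ i ∈ S, ∀ ξ, ∀ c > 0, Φ i (c • ξ) = c * Φ i ξ)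
    (hanalytic : ∀ i ∈ S, ∀ w w', planeDet w w' ≠ 0 →
      ∀ᵐ x : ℝ, AnalyticAt ℝ (fun x => Φ i (x • w + w')) x)
    {η : ℝ} (hη : ∀ c : ℝ, c ≠ 0 → ∀ w', planeDet !₂[1, η] w' ≠ 0 →
      ∀ x, ¬ IsPolynomialNear (fun x => Φ i₀ (x • c • !₂[1, η] + w')) x)
    {g : SL2R} {a : ι → ℤ × ℤ} (hg : ∀ i ∈ S, matVec g (a i) 1 ≠ 0)
    (ha : ∀ i ∈ S, i ≠ i₀ → (a i).1 * (a i₀).2 - (a i).2 * (a i₀).1 ≠ 0)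
    {N : Set ℝ} (hN : volume N = 0) :
    ∀ᵐ r, ∀ᵐ s, ∑ i ∈ S, Φ i (matVec (slantedFlow η (r, s) * g) (a i)) ∉ N := by
  let φ (i : ι) (x : ℝ) : ℝ :=
    Φ i (x • matVec g (a i) 1 • !₂[1, η] + matVec g (a i) 1 • !₂[0, 1])
  let τ (i : ι) : ℝ := matVec g (a i) 0 / matVec g (a i) 1
  have hφ : ∀ i ∈ S, ∀ᵐ x, AnalyticAt ℝ (φ i) x := fun i hi =>
    hanalytic i hi _ _ (by simpa [planeDet] using hg i hi)
  have hτ : ∀ i ∈ S, i ≠ i₀ → τ i ≠ τ i₀ := fun i hi hne heq => by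
    rw [div_eq_div_iff (hg i hi) (hg i₀ hi₀)] at heq
    refine ha i hi hne (Int.cast_eq_zero (α := ℝ).1 ?_)
    rw [← planeDet_matVec g, planeDet]
    linarith
  have hpoly : ∀ x, ¬ IsPolynomialNear (φ i₀) x :=
    hη _ (hg i₀ hi₀) _ (by simpa [planeDet] using hg i₀ hi₀)
  have hexp : ∀ᵐ r : ℝ, HasStrictDerivAt (fun r => Real.exp (2 * r))
      (Real.exp (2 * r) * (2 * 1)) r ∧ Real.exp (2 * r) * (2 * 1) ≠ 0 :=
    Eventually.of_forall fun r => ⟨((hasStrictDerivAt_id r).const_mul 2).exp, by positivity⟩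
  filter_upwards [ae_notMem_of_ae_hasStrictDerivAt hexp
    (ae_forall_null_ae_sum_translate_notMem hi₀ hφ hτ hpoly)] with r hr
  have hscale : volume ((Real.exp (-r) * ·) ⁻¹' N) = 0 := by
    rw [Real.volume_preimage_mul_left (Real.exp_ne_zero _), hN, mul_zero]
  filter_upwards [Set.notMem_compl_iff.1 hr _ hscale] with s hs
  rw [Set.mem_preimage, Finset.mul_sum] at hs
  rw [Finset.sum_congr rfl fun i hi => ?_]
  · exact hs
  rw [matVec_slantedFlow_mul η r s (hg i hi), hsmul i hi _ _ (Real.exp_pos _)]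

theorem ae_sum_latticeVec_slantedFlow_notMem (hi₀ : i₀ ∈ S)
    {k : ι → ℤ × ℤ} (hk : ∀ i, k i ∈ PrimeIndex) (hinj : Function.Injective k)
    (hsmul : ∀ i ∈ S, ∀ ξ, ∀ c > 0, Φ i (c • ξ) = c * Φ i ξ)
    (hanalytic : ∀ i ∈ S, ∀ w w', planeDet w w' ≠ 0 →
      ∀ᵐ x : ℝ, AnalyticAt ℝ (fun x => Φ i (x • w + w')) x)
    {η : ℝ} (hη : ∀ c : ℝ, c ≠ 0 → ∀ w', planeDet !₂[1, η] w' ≠ 0 →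
      ∀ x, ¬ IsPolynomialNear (fun x => Φ i₀ (x • c • !₂[1, η] + w')) x)
    {L : LatticeSpace} (hL : ∀ v ∈ latticeVectors L, v ≠ 0 → v 1 ≠ 0)
    {N : Set ℝ} (hN : volume N = 0) :
    ∀ᵐ r, ∀ᵐ s, IsGenericLattice (slantedFlow η (r, s) • L) →
      ∑ i ∈ S, Φ i (latticeVec (k i) (slantedFlow η (r, s) • L)) ∉ N := by
  obtain ⟨g, rfl⟩ := QuotientGroup.mk_surjective L
  have hall : ∀ᵐ r, ∀ᵐ s, ∀ m n : ℤ × ℤ, m.1 * n.2 - m.2 * n.1 ≠ 0 →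
      ∑ i ∈ S, Φ i (matVec (slantedFlow η (r, s) * g) ((k i).1 • m + (k i).2 • n)) ∉ N := by
    simp only [ae_all_iff]
    intro m n hmn
    refine ae_sum_slantedFlow_notMem hi₀ hsmul hanalytic hη (fun i _ => ?_) (fun i _ hne => ?_) hN
    · exact hL _ (matVec_mem_latticeVectors g _)
        (matVec_eq_zero_iff.not.2 (zsmul_add_zsmul_ne_zero hmn (PrimeIndex.ne_zero (hk i))))
    · have hdet := mul_ne_zero hmn fun h0 =>
        hne (hinj (PrimeIndex.eq_of_det_eq_zero (hk i) (hk i₀) h0))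
      convert hdet using 1
      simp only [Prod.fst_add, Prod.snd_add, Prod.smul_fst, Prod.smul_snd, smul_eq_mul]
      ring
  refine hall.mono fun r hr => hr.mono fun s hs hgen => ?_
  obtain ⟨m, n, hmn, hdet⟩ := IsGenericLattice.exists_minimalPair_eq
    (g := slantedFlow η (r, s) * g) hgen
  have hsum := hs m n hdet
  simp only [← latticeVec_mk hmn] at hsum
  exact hsum

theorem map_sum_latticeVec_absolutelyContinuous (hi₀ : i₀ ∈ S)
    {k : ι → ℤ × ℤ} (hk : ∀ i, k i ∈ PrimeIndex) (hinj : Function.Injective k)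
    (hcont : ∀ i ∈ S, Continuous (Φ i))
    (hsmul : ∀ i ∈ S, ∀ ξ, ∀ c > 0, Φ i (c • ξ) = c * Φ i ξ)
    (hanalytic : ∀ i ∈ S, ∀ w w', planeDet w w' ≠ 0 →
      ∀ᵐ x : ℝ, AnalyticAt ℝ (fun x => Φ i (x • w + w')) x)
    (haffine : ∀ w w', planeDet w w' ≠ 0 → ∀ τ α β : ℝ,
      ¬ ∀ᶠ x in 𝓝 τ, Φ i₀ (x • w + w') = α * x + β) :
    μ.map (fun L => ∑ i ∈ S, Φ i (latticeVec (k i) L)) ≪ volume := by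
  have hF : AEMeasurable (fun L => ∑ i ∈ S, Φ i (latticeVec (k i) L)) μ :=
    Finset.aemeasurable_fun_sum _ fun i hi =>
      (hcont i hi).measurable.comp_aemeasurable (aemeasurable_latticeVec (k i))
  refine Measure.AbsolutelyContinuous.mk fun N hN hN0 => ?_
  rw [Measure.map_apply_of_aemeasurable hF hN, measure_eq_zero_iff_ae_notMem]
  obtain ⟨η, hη⟩ := exists_forall_not_isPolynomialNear (hsmul i₀ hi₀) haffine
  refine ae_notMem_of_ae_smul_notMem (N := N) hF hN (continuous_slantedFlow η) ?_
  filter_upwards [ae_snd_ne_zero (μ := μ)] with L hL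
  exact ae_sum_latticeVec_slantedFlow_notMem hi₀ hk hinj hsmul hanalytic hη hL hN0

end Invariant

/-! ### Bounded families of functionals -/

section DenseSpan

open scoped NNReal

variable {X E G 𝕜 ι : Type*} [MeasurableSpace X] {ν : Measure X} [RCLike 𝕜]
  [NormedAddCommGroup E] [NormedSpace 𝕜 E] [NormedAddCommGroup G] [NormedSpace 𝕜 G]

theorem integrable_clm_apply {T : X → E →L[𝕜] G} {C : ℝ≥0} (hT : ∀ x, ‖T x‖ ≤ C) {f : X → E}
    (hTf : AEStronglyMeasurable (fun x => T x (f x)) ν) (hf : Integrable f ν) :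
    Integrable (fun x => T x (f x)) ν :=
  (hf.norm.const_mul (C : ℝ)).mono' hTf (.of_forall fun x => (T x).le_of_opNorm_le (hT x) _)

variable [NormedSpace ℝ G]

theorem norm_integral_clm_apply_le {T : X → E →L[𝕜] G} {C : ℝ≥0} (hT : ∀ x, ‖T x‖ ≤ C)
    {f : X → E} (hf : Integrable f ν) : ‖∫ x, T x (f x) ∂ν‖ ≤ C * ∫ x, ‖f x‖ ∂ν := by
  rw [← integral_const_mul]
  exact norm_integral_le_of_norm_le (hf.norm.const_mul _)
    (.of_forall fun x => (T x).le_of_opNorm_le (hT x) _)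

variable {T : ι → X → E →L[𝕜] G} {C : ℝ≥0} {l : Filter ι}

theorem tendsto_integral_clm_apply_of_forall_setIntegral (hT : ∀ i x, ‖T i x‖ ≤ C)
    (hmeas : ∀ i, ∀ f : X → E, AEStronglyMeasurable f ν →
      AEStronglyMeasurable (fun x => T i x (f x)) ν)
    (hlim : ∀ c, ∀ s, MeasurableSet s → ν s < ⊤ →
      Tendsto (fun i => ∫ x in s, T i x c ∂ν) l (𝓝 0))
    {f : X → E} (hf : Integrable f ν) : Tendsto (fun i => ∫ x, T i x (f x) ∂ν) l (𝓝 0) := by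
  have hint : ∀ i, ∀ f : X → E, Integrable f ν → Integrable (fun x => T i x (f x)) ν :=
    fun i f hf => integrable_clm_apply (hT i) (hmeas i f hf.aestronglyMeasurable) hf
  refine Integrable.induction (fun f => Tendsto (fun i => ∫ x, T i x (f x) ∂ν) l (𝓝 0))
    (fun c s hs hνs => ?_) (fun f g _ hf hg hf0 hg0 => ?_) ?_ (fun f g hfg _ hf0 => ?_) hf
  · refine (hlim c s hs hνs).congr fun i => ?_
    rw [← integral_indicator hs]
    refine integral_congr_ae (.of_forall fun x => ?_)
    by_cases hx : x ∈ s <;> simp [hx]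
  · simpa only [Pi.add_apply, map_add, integral_add (hint _ _ hf) (hint _ _ hg), add_zero]
      using hf0.add hg0
  · have hlip : ∀ i, LipschitzWith C fun f : X →₁[ν] E => ∫ x, T i x (f x) ∂ν := fun i =>
      LipschitzWith.of_dist_le_mul fun f g => by
        have hfi := L1.integrable_coeFn f
        have hgi := L1.integrable_coeFn g
        rw [dist_eq_norm, ← integral_sub (hint i _ hfi) (hint i _ hgi), L1.dist_eq_integral_dist]
        simpa only [← map_sub, dist_eq_norm, Pi.sub_apply]
          using norm_integral_clm_apply_le (hT i) (hfi.sub hgi)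
    exact (LipschitzWith.uniformEquicontinuous _ C hlip).equicontinuous.isClosed_setOfPred_tendsto
      continuous_const
  · refine hf0.congr fun i => integral_congr_ae ?_
    filter_upwards [hfg] with x hx
    rw [hx]

theorem tendsto_integral_clm_apply_const_of_dense_span [SMulCommClass ℝ 𝕜 G] [IsFiniteMeasure ν]
    (hT : ∀ i x, ‖T i x‖ ≤ C) (hmeas : ∀ i c, AEStronglyMeasurable (fun x => T i x c) ν)
    {A : Set E} (hA : Dense (Submodule.span 𝕜 A : Set E))
    (hlim : ∀ a ∈ A, Tendsto (fun i => ∫ x, T i x a ∂ν) l (𝓝 0)) (c : E) :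
    Tendsto (fun i => ∫ x, T i x c ∂ν) l (𝓝 0) := by
  have hint : ∀ i c, Integrable (fun x => T i x c) ν := fun i c =>
    integrable_clm_apply (hT i) (hmeas i c) (integrable_const c)
  have hlip : ∀ i, LipschitzWith (C * (ν Set.univ).toNNReal) fun c => ∫ x, T i x c ∂ν := fun i =>
    LipschitzWith.of_dist_le_mul fun c d => by
      rw [dist_eq_norm, dist_eq_norm, ← integral_sub (hint i c) (hint i d)]
      simp only [← map_sub]
      refine (norm_integral_clm_apply_le (hT i) (integrable_const (c - d))).trans_eq ?_
      rw [integral_const, smul_eq_mul, ← mul_assoc]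
      rfl
  have hclosed : IsClosed {c | Tendsto (fun i => ∫ x, T i x c ∂ν) l (𝓝 0)} :=
    (LipschitzWith.uniformEquicontinuous _ _ hlip).equicontinuous.isClosed_setOfPred_tendsto
      continuous_const
  refine hclosed.closure_subset_iff.2 (fun d hd => ?_) (hA c)
  induction hd using Submodule.span_induction with
  | mem a ha => exact hlim a ha
  | zero =>
    simpa only [Set.mem_ofPred_eq, map_zero, integral_zero] using tendsto_const_nhds
  | add c d _ _ hc hd =>
    simpa only [Set.mem_ofPred_eq, map_add, integral_add (hint _ c) (hint _ d), add_zero]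
      using Tendsto.add hc hd
  | smul z c _ hc =>
    simpa only [Set.mem_ofPred_eq, map_smul, integral_smul, smul_zero]
      using Tendsto.const_smul hc z

end DenseSpan

/-! ### The Riemann–Lebesgue lemma -/

theorem continuous_expCircle : Continuous expCircle :=
  continuous_subtype_val.comp AddCircle.continuous_toCircle

theorem norm_expCircle (θ : UnitAddCircle) : ‖expCircle θ‖ = 1 := Circle.norm_coe _

theorem expCircle_zero : expCircle 0 = 1 := by
  rw [expCircle, AddCircle.toCircle_zero, Circle.coe_one]

theorem expCircle_add (x y : UnitAddCircle) : expCircle (x + y) = expCircle x * expCircle y := by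
  rw [expCircle, AddCircle.toCircle_add, Circle.coe_mul, ← expCircle, ← expCircle]

theorem expCircle_sum {ι : Type*} (S : Finset ι) (f : ι → UnitAddCircle) :
    expCircle (∑ i ∈ S, f i) = ∏ i ∈ S, expCircle (f i) := by
  classical
  induction S using Finset.induction_on with
  | empty => rw [Finset.sum_empty, Finset.prod_empty, expCircle_zero]
  | insert a S ha ih => rw [Finset.sum_insert ha, Finset.prod_insert ha, expCircle_add, ih]

theorem star_expCircle (x : UnitAddCircle) : star (expCircle x) = expCircle (-x) := by
  rw [expCircle, expCircle, AddCircle.toCircle_neg, Circle.coe_inv_eq_conj, starRingEnd_apply]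

theorem injective_expCircle : Function.Injective expCircle :=
  Circle.coe_injective.comp (AddCircle.injective_toCircle one_ne_zero)

theorem expCircle_coe (x : ℝ) : expCircle (x : UnitAddCircle) = Real.fourierChar x := by
  rw [expCircle, AddCircle.toCircle_apply_mk, div_one, Real.fourierChar_apply']

theorem continuous_expCircle_mul (t : ℝ) :
    Continuous fun y : ℝ => expCircle ((t * y : ℝ) : UnitAddCircle) :=
  continuous_expCircle.comp ((AddCircle.continuous_mk' 1).comp (continuous_const_mul t))

theorem tendsto_integral_expCircle_mul {m : Measure ℝ} [SigmaFinite m] (hm : m ≪ volume) :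
    Tendsto (fun t : ℝ => ∫ y, expCircle ((t * y : ℝ) : UnitAddCircle) ∂m) atTop (𝓝 0) := by
  have hlim := Real.tendsto_integral_exp_smul_cocompact
    fun y => ((m.rnDeriv volume y).toReal : ℂ)
  have hneg : Tendsto (fun t : ℝ => -t) atTop (cocompact ℝ) := by
    rw [cocompact_eq_atBot_atTop]
    exact tendsto_neg_atTop_atBot.mono_right le_sup_left
  refine (hlim.comp hneg).congr fun t => ?_
  rw [← integral_rnDeriv_smul hm]
  refine integral_congr_ae (.of_forall fun y => ?_)
  dsimp only
  rw [expCircle_coe, Circle.smul_def, smul_eq_mul, Complex.real_smul, mul_neg, neg_neg, mul_comm y,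
    mul_comm]

theorem tendsto_integral_mul_expCircle {X : Type*} [MeasurableSpace X] {ν : Measure X}
    [IsFiniteMeasure ν] {F : X → ℝ} (hF : AEMeasurable F ν) (hac : ν.map F ≪ volume)
    {φ : X → ℂ} (hφ : Integrable φ ν) :
    Tendsto (fun t : ℝ => ∫ x, φ x * expCircle ((t * F x : ℝ) : UnitAddCircle) ∂ν)
      atTop (𝓝 0) := by
  set T : ℝ → X → ℂ →L[ℂ] ℂ :=
    fun t x => ContinuousLinearMap.mul ℂ ℂ (expCircle ((t * F x : ℝ) : UnitAddCircle)) with hT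
  have hmeas : ∀ t : ℝ, AEStronglyMeasurable
      (fun x => expCircle ((t * F x : ℝ) : UnitAddCircle)) ν := fun t =>
    ((continuous_expCircle_mul t).measurable.comp_aemeasurable hF).aestronglyMeasurable
  have hlim := tendsto_integral_clm_apply_of_forall_setIntegral (T := T) (C := 1) (l := atTop)
    (fun t x => by
      rw [hT, ContinuousLinearMap.opNorm_mul_apply, norm_expCircle, NNReal.coe_one])
    (fun t f hf => (hmeas t).mul hf) (fun c s _ _ => ?_) hφ
  · simpa only [hT, ContinuousLinearMap.mul_apply', mul_comm (φ _)] using hlim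
  · have hs : (ν.restrict s).map F ≪ volume :=
      (Measure.map_mono_of_aemeasurable Measure.restrict_le_self hF).absolutelyContinuous.trans hac
    have hs0 := (tendsto_integral_expCircle_mul hs).mul_const c
    simp only [integral_map hF.restrict (continuous_expCircle_mul _).aestronglyMeasurable,
      zero_mul] at hs0
    simpa only [hT, ContinuousLinearMap.mul_apply', integral_mul_const] using hs0

/-! ### Characters and convergence in distribution -/

section Characters

variable {K A : Type*} [TopologicalSpace K]

section AddMonoid

variable [AddMonoid A]

/-- The functions `y ↦ e(c a y)` attached to a group of maps `c a : K → ℝ/ℤ`: products of these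
functions correspond to sums in `A`. -/
def expCharacter (c : A →+ C(K, UnitAddCircle)) : Multiplicative A →* C(K, ℂ) where
  toFun a := ⟨fun y => expCircle (c a.toAdd y), continuous_expCircle.comp (c a.toAdd).continuous⟩
  map_one' := by
    ext y
    simp only [toAdd_one, map_zero, ContinuousMap.coe_mk, ContinuousMap.zero_apply,
      ContinuousMap.one_apply, expCircle_zero]
  map_mul' a b := by
    ext y
    simp only [toAdd_mul, map_add, ContinuousMap.coe_mk, ContinuousMap.add_apply,
      ContinuousMap.mul_apply, expCircle_add]

theorem expCharacter_apply (c : A →+ C(K, UnitAddCircle)) (a : Multiplicative A) (y : K) :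
    expCharacter c a y = expCircle (c a.toAdd y) := rfl

end AddMonoid

variable [CompactSpace K]

theorem dense_span_range_expCharacter [AddGroup A] {c : A →+ C(K, UnitAddCircle)}
    (hsep : ∀ x y, x ≠ y → ∃ a, c a x ≠ c a y) :
    Dense (Submodule.span ℂ (Set.range (expCharacter c)) : Set C(K, ℂ)) := by
  have hstar : star (Set.range (expCharacter c)) ⊆ Set.range (expCharacter c) := by
    rintro f ⟨a, ha⟩
    refine ⟨a⁻¹, ?_⟩
    rw [← star_star f, ← ha]
    ext y
    rw [ContinuousMap.star_apply, expCharacter_apply, expCharacter_apply, star_expCircle,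
      toAdd_inv, map_neg, ContinuousMap.neg_apply]
  set S := StarAlgebra.adjoin ℂ (Set.range (expCharacter c)) with hS
  have hspan : (S : Set C(K, ℂ)) = Submodule.span ℂ (Set.range (expCharacter c)) := by
    have hadj : Subalgebra.toSubmodule S.toSubalgebra =
        Submodule.span ℂ (Set.range (expCharacter c)) := by
      rw [hS, StarAlgebra.adjoin_toSubalgebra, Set.union_eq_self_of_subset_right hstar,
        Algebra.adjoin_eq_span, ← MonoidHom.coe_mrange, Submonoid.closure_eq]
    rw [← hadj]
    rfl
  have hdense : S.topologicalClosure = ⊤ := by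
    refine ContinuousMap.starSubalgebra_topologicalClosure_eq_top_of_separatesPoints S
      fun x y hxy => ?_
    obtain ⟨a, ha⟩ := hsep x y hxy
    exact ⟨_, ⟨_, StarAlgebra.subset_adjoin ℂ _ ⟨Multiplicative.ofAdd a, rfl⟩, rfl⟩,
      injective_expCircle.ne ha⟩
  rw [← hspan, dense_iff_closure_eq, ← StarSubalgebra.topologicalClosure_coe, hdense]
  rfl

variable [MeasurableSpace K]

theorem norm_integral_continuousMap_le {κ : Measure K} [IsProbabilityMeasure κ] (f : C(K, ℂ)) :
    ‖∫ y, f y ∂κ‖ ≤ ‖f‖ := by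
  simpa only [probReal_univ, mul_one]
    using norm_integral_le_of_norm_le_const (μ := κ) (.of_forall f.norm_coe_le_norm)

variable [BorelSpace K]

/-- Integration against a probability measure, as a continuous functional on `C(K, ℂ)`. -/
def meanCLM (κ : Measure K) [IsProbabilityMeasure κ] : C(K, ℂ) →L[ℂ] ℂ :=
  have hint : ∀ f : C(K, ℂ), Integrable f κ := fun f =>
    f.continuous.integrable_of_hasCompactSupport (.of_compactSpace f)
  LinearMap.mkContinuous
    { toFun := fun f => ∫ y, f y ∂κ
      map_add' := fun f g => integral_add (hint f) (hint g)
      map_smul' := fun z f => integral_const_mul z f } 1 fun f =>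
    (norm_integral_continuousMap_le f).trans_eq (one_mul _).symm

/-- The functional `f ↦ f y₀ - ∫ f dκ`: the signed measure `δ_{y₀} - κ`, whose vanishing in the
mean expresses asymptotic equidistribution. -/
def deviation (κ : Measure K) [IsProbabilityMeasure κ] (y₀ : K) : C(K, ℂ) →L[ℂ] ℂ :=
  ContinuousMap.evalCLM ℂ y₀ - meanCLM κ

variable {κ : Measure K} [IsProbabilityMeasure κ]

theorem deviation_apply (y₀ : K) (f : C(K, ℂ)) : deviation κ y₀ f = f y₀ - ∫ y, f y ∂κ := rfl

theorem norm_deviation_le (y₀ : K) : ‖deviation κ y₀‖ ≤ 2 :=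
  ContinuousLinearMap.opNorm_le_bound _ zero_le_two fun f => by
    rw [deviation_apply, two_mul]
    exact norm_sub_le_of_le (f.norm_coe_le_norm y₀) (norm_integral_continuousMap_le f)

theorem deviation_expCharacter [AddMonoid A] {c : A →+ C(K, UnitAddCircle)}
    (hκ : ∀ a, a ≠ 0 → ∫ y, expCircle (c a y) ∂κ = 0) {a : A} (ha : a ≠ 0) (y₀ : K) :
    deviation κ y₀ (expCharacter c (.ofAdd a)) = expCircle (c a y₀) := by
  simp only [deviation_apply, expCharacter_apply, toAdd_ofAdd, hκ a ha, sub_zero]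

theorem deviation_one (y₀ : K) : deviation κ y₀ 1 = 0 := by
  simp only [deviation_apply, ContinuousMap.one_apply, integral_const, probReal_univ, one_smul,
    sub_self]

variable {X : Type*} [MeasurableSpace X] {ν : Measure X}
  [SecondCountableTopology K] [TopologicalSpace.PseudoMetrizableSpace K]
  {ι : Type*} {l : Filter ι} {Θ : ι → X → K}

theorem aestronglyMeasurable_deviation {Θ : X → K} (hΘ : AEMeasurable Θ ν)
    {φ : X → C(K, ℂ)} (hφ : AEStronglyMeasurable φ ν) :
    AEStronglyMeasurable (fun x => deviation κ (Θ x) (φ x)) ν :=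
  (continuous_eval.comp_aestronglyMeasurable (hφ.prodMk hΘ.aestronglyMeasurable)).sub
    ((meanCLM κ).continuous.comp_aestronglyMeasurable hφ)

theorem tendsto_integral_deviation [AddGroup A] [IsFiniteMeasure ν]
    (hΘ : ∀ t, AEMeasurable (Θ t) ν) {c : A →+ C(K, UnitAddCircle)}
    (hsep : ∀ x y, x ≠ y → ∃ a, c a x ≠ c a y)
    (hκ : ∀ a, a ≠ 0 → ∫ y, expCircle (c a y) ∂κ = 0)
    (hlim : ∀ a, a ≠ 0 → ∀ s, MeasurableSet s →
      Tendsto (fun t => ∫ x in s, expCircle (c a (Θ t x)) ∂ν) l (𝓝 0))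
    {φ : X → C(K, ℂ)} (hφ : Integrable φ ν) :
    Tendsto (fun t => ∫ x, deviation κ (Θ t x) (φ x) ∂ν) l (𝓝 0) := by
  have hbound : ∀ t x, ‖deviation κ (Θ t x)‖ ≤ (2 : NNReal) := fun t x => norm_deviation_le _
  refine tendsto_integral_clm_apply_of_forall_setIntegral hbound
    (fun t f hf => aestronglyMeasurable_deviation (hΘ t) hf) (fun f s hs _ => ?_) hφ
  refine tendsto_integral_clm_apply_const_of_dense_span hbound
    (fun t f => aestronglyMeasurable_deviation (hΘ t).restrict aestronglyMeasurable_const)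
    (dense_span_range_expCharacter hsep) ?_ f
  rintro _ ⟨a, rfl⟩
  by_cases ha : a = 1
  · simpa only [ha, map_one, deviation_one, integral_zero] using tendsto_const_nhds
  · simpa only [← deviation_expCharacter hκ (a := a.toAdd) ha, ofAdd_toAdd]
      using hlim a.toAdd ha s hs

theorem tendstoInDistribution_of_characters [AddGroup A] [TopologicalSpace X]
    [SecondCountableTopology X] [BorelSpace X] [IsProbabilityMeasure ν]
    (hΘ : ∀ t, AEMeasurable (Θ t) ν) {c : A →+ C(K, UnitAddCircle)}
    (hsep : ∀ x y, x ≠ y → ∃ a, c a x ≠ c a y)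
    (hκ : ∀ a, a ≠ 0 → ∫ y, expCircle (c a y) ∂κ = 0)
    (hlim : ∀ a, a ≠ 0 → ∀ s, MeasurableSet s →
      Tendsto (fun t => ∫ x in s, expCircle (c a (Θ t x)) ∂ν) l (𝓝 0)) :
    TendstoInDistribution (fun t x => (x, Θ t x)) l (id : X × K → X × K)
      (fun _ => ν) (ν.prod κ) where
  forall_aemeasurable t := aemeasurable_id.prodMk (hΘ t)
  aemeasurable_limit := aemeasurable_id
  tendsto := by
    refine (ProbabilityMeasure.tendsto_iff_forall_integral_rclike_tendsto ℂ).2 fun f => ?_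
    set φ : C(X, C(K, ℂ)) := ContinuousMap.curry f.toContinuousMap
    have hφ_int : Integrable φ ν :=
      .of_bound φ.continuous.aestronglyMeasurable ‖f‖ <| .of_forall fun x =>
        (ContinuousMap.norm_le _ (norm_nonneg f)).2 fun y => f.norm_coe_le_norm (x, y)
    have hdist : ∀ t, ∫ z, f z ∂(ν.map fun x => (x, Θ t x)) - ∫ z, f z ∂((ν.prod κ).map id) =
        ∫ x, deviation κ (Θ t x) (φ x) ∂ν := fun t => by
      have hmeas : AEMeasurable (fun x => (x, Θ t x)) ν := aemeasurable_id.prodMk (hΘ t)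
      rw [integral_map hmeas f.continuous.aestronglyMeasurable, Measure.map_id,
        integral_prod _ (f.integrable _), ← integral_sub]
      · rfl
      · exact .of_bound (f.continuous.measurable.comp_aemeasurable hmeas).aestronglyMeasurable ‖f‖
          (.of_forall fun x => f.norm_coe_le_norm _)
      · exact (f.integrable (ν.prod κ)).integral_prod_left
    have hlim0 := tendsto_integral_deviation hΘ hsep hκ hlim hφ_int
    simp only [← hdist] at hlim0
    simpa only [ProbabilityMeasure.coe_mk] using tendsto_sub_nhds_zero_iff.1 hlim0

end Characters

section ProdPairing

variable {K K' A B : Type*} [TopologicalSpace K] [TopologicalSpace K'] [AddMonoid A] [AddMonoid B]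

/-- The maps `(x, y) ↦ c a x + d b y` on a product space attached to two groups of maps `c a` and
`d b` to the circle. -/
def prodPairing (c : A →+ C(K, UnitAddCircle)) (d : B →+ C(K', UnitAddCircle)) :
    A × B →+ C(K × K', UnitAddCircle) :=
  ((ContinuousMap.compAddMonoidHom' ContinuousMap.fst).comp c).coprod
    ((ContinuousMap.compAddMonoidHom' ContinuousMap.snd).comp d)

variable {c : A →+ C(K, UnitAddCircle)} {d : B →+ C(K', UnitAddCircle)}

theorem prodPairing_apply (a : A × B) (y : K × K') :
    prodPairing c d a y = c a.1 y.1 + d a.2 y.2 := rfl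

theorem exists_prodPairing_ne (hc : ∀ x y, x ≠ y → ∃ a, c a x ≠ c a y)
    (hd : ∀ x y, x ≠ y → ∃ b, d b x ≠ d b y) (x y : K × K') (hxy : x ≠ y) :
    ∃ a, prodPairing c d a x ≠ prodPairing c d a y := by
  rcases not_and_or.1 (mt Prod.ext_iff.2 hxy) with h1 | h2
  · obtain ⟨a, ha⟩ := hc _ _ h1
    exact ⟨(a, 0), by simpa only [prodPairing_apply, map_zero, ContinuousMap.zero_apply, add_zero]⟩
  · obtain ⟨b, hb⟩ := hd _ _ h2
    exact ⟨(0, b), by simpa only [prodPairing_apply, map_zero, ContinuousMap.zero_apply, zero_add]⟩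

theorem integral_prodPairing_eq_zero [MeasurableSpace K] [MeasurableSpace K'] {κ : Measure K}
    {κ' : Measure K'} [SFinite κ] [SFinite κ']
    (hc : ∀ a, a ≠ 0 → ∫ x, expCircle (c a x) ∂κ = 0)
    (hd : ∀ b, b ≠ 0 → ∫ y, expCircle (d b y) ∂κ' = 0) (a : A × B) (ha : a ≠ 0) :
    ∫ y, expCircle (prodPairing c d a y) ∂(κ.prod κ') = 0 := by
  simp only [prodPairing_apply, expCircle_add]
  rw [integral_prod_mul (fun x => expCircle (c a.1 x)) fun y => expCircle (d a.2 y)]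
  rcases not_and_or.1 (mt Prod.ext_iff.2 ha) with h1 | h2
  · rw [hc _ h1, zero_mul]
  · rw [hd _ h2, mul_zero]

end ProdPairing

section Torus

variable {ι : Type*}

/-- The duality between the torus `(ℝ/ℤ)^ι` and its group of characters: the exponents `n` give
the map `θ ↦ ∑ i, n i • θ i`. -/
def torusPairing : (ι →₀ ℤ) →+ C(ι → UnitAddCircle, UnitAddCircle) where
  toFun n := ⟨fun θ => n.sum fun i a => a • θ i,
    continuous_finsetSum _ fun i _ => (continuous_apply i).zsmul _⟩
  map_zero' := rfl
  map_add' m n := by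
    classical
    ext θ
    exact Finsupp.sum_add_index' (h := fun i a => a • θ i) (fun i => zero_zsmul _)
      fun i a b => add_zsmul _ _ _

theorem torusPairing_eq_sum {n : ι →₀ ℤ} {S : Finset ι} (hS : n.support ⊆ S)
    (θ : ι → UnitAddCircle) : torusPairing n θ = ∑ i ∈ S, n i • θ i :=
  Finsupp.sum_of_support_subset _ hS (fun i a => a • θ i) fun _ _ => zero_zsmul _

theorem exists_torusPairing_ne (θ θ' : ι → UnitAddCircle) (h : θ ≠ θ') :
    ∃ n, torusPairing n θ ≠ torusPairing n θ' := by
  classical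
  obtain ⟨i, hi⟩ := Function.ne_iff.1 h
  refine ⟨Finsupp.single i 1, ?_⟩
  simpa only [torusPairing_eq_sum Finsupp.support_single_subset, Finset.sum_singleton,
    Finsupp.single_eq_same, one_zsmul] using hi

theorem integral_expCircle_zsmul {n : ℤ} (hn : n ≠ 0) :
    ∫ θ : UnitAddCircle, expCircle (n • θ) ∂AddCircle.haarAddCircle = 0 := by
  have htrans := integral_add_right_eq_self (μ := AddCircle.haarAddCircle)
    (fun θ => fourier (T := (1 : ℝ)) n θ) ((1 / 2 / n : ℝ) : UnitAddCircle)
  simp only [fourier_add_half_inv_index hn one_pos, integral_neg] at htrans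
  exact self_eq_neg.1 htrans.symm

theorem integral_torusPairing_eq_zero (n : ι →₀ ℤ) (hn : n ≠ 0) :
    ∫ θ, expCircle (torusPairing n θ) ∂Measure.infinitePi
      (fun _ : ι => (AddCircle.haarAddCircle : Measure UnitAddCircle)) = 0 := by
  obtain ⟨k, hk⟩ := Finsupp.support_nonempty_iff.2 hn
  have hprod : ∀ θ : ι → UnitAddCircle, expCircle (torusPairing n θ) =
      ∏ i : n.support, expCircle (n i • n.support.restrict θ i) := fun θ => by
    rw [torusPairing_eq_sum subset_rfl, expCircle_sum, ← Finset.prod_coe_sort]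
    rfl
  have hcont : Continuous fun u : n.support → UnitAddCircle =>
      ∏ i : n.support, expCircle (n i • u i) :=
    continuous_finsetProd _ fun i _ => continuous_expCircle.comp ((continuous_apply i).zsmul _)
  simp only [hprod]
  have hrestrict := integral_restrict_infinitePi
    (fun _ : ι => (AddCircle.haarAddCircle : Measure UnitAddCircle)) hcont.aestronglyMeasurable
  refine hrestrict.trans ?_
  rw [integral_fintype_prod_eq_prod (fun (i : n.support) θ => expCircle (n i • θ))]
  exact Finset.prod_eq_zero (Finset.mem_univ ⟨k, hk⟩)
    (integral_expCircle_zsmul (Finsupp.mem_support_iff.1 hk))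

end Torus

/-! ### Equidistribution of the phases -/

theorem absolutelyContinuous_map_of_aemeasurable {X Y : Type*} [MeasurableSpace X]
    [MeasurableSpace Y] {μ ν : Measure X} (hν : ν ≪ μ) {f : X → Y} (hf : AEMeasurable f μ) :
    ν.map f ≪ μ.map f :=
  .mk fun s hs h0 => by
    rw [Measure.map_apply_of_aemeasurable hf hs] at h0
    rw [Measure.map_apply_of_aemeasurable (hf.mono_ac hν) hs, hν h0]

theorem IsSmoothOnLattices.continuous {E : Type*} [NormedAddCommGroup E] [NormedSpace ℝ E]
    {f : LatticeSpace → E} (hf : IsSmoothOnLattices f) : Continuous f := by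
  obtain ⟨G, hG, hfG⟩ := hf
  have hquot : IsQuotientMap (QuotientGroup.mk : SL2R → LatticeSpace) := isQuotientMap_quot_mk
  rw [hquot.continuous_iff, show f ∘ QuotientGroup.mk = _ from funext hfG]
  exact hG.continuous.comp (continuous_pi fun i => continuous_pi fun j => continuous_entry i j)

theorem IsSmoothOnLattices.integrable {E : Type*} [NormedAddCommGroup E] [NormedSpace ℝ E]
    {f : LatticeSpace → E} (hf : IsSmoothOnLattices f) (hsupp : HasCompactSupport f)
    (ν : Measure LatticeSpace) [IsFiniteMeasureOnCompacts ν] : Integrable f ν :=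
  hf.continuous.integrable_of_hasCompactSupport hsupp

theorem latticeVec_neg (k : ℤ × ℤ) (L : LatticeSpace) : latticeVec (-k) L = -latticeVec k L := by
  simp only [latticeVec, Prod.fst_neg, Prod.snd_neg, Int.cast_neg, neg_smul, neg_add]

theorem zsmul_phase (γ : ℝ → Plane) (n : ℤ) (k : ℤ × ℤ) (t : ℝ) (L : LatticeSpace) :
    n • phase γ k t L = ((t * (n * curveY γ (latticeVec k L)) : ℝ) : UnitAddCircle) := by
  rw [phase, ← AddCircle.coe_zsmul, zsmul_eq_mul, mul_left_comm]

theorem sum_phase_eq (γ : ℝ → Plane) {ι : Type*} (S : Finset ι) (k : ι → ℤ × ℤ) (p q : ι → ℤ)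
    (t : ℝ) (L : LatticeSpace) :
    ∑ i ∈ S, p i • phase γ (k i) t L + ∑ i ∈ S, q i • phase γ (-k i) t L =
      ((t * ∑ i ∈ S, twoSidedY γ (p i) (q i) (latticeVec (k i) L) : ℝ) : UnitAddCircle) := by
  have hcoe : ((t * ∑ i ∈ S, twoSidedY γ (p i) (q i) (latticeVec (k i) L) : ℝ) : UnitAddCircle) =
      ∑ i ∈ S, ((t * twoSidedY γ (p i) (q i) (latticeVec (k i) L) : ℝ) : UnitAddCircle) := by
    rw [Finset.mul_sum]
    exact map_sum (QuotientAddGroup.mk' (AddSubgroup.zmultiples (1 : ℝ))) _ S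
  rw [hcoe, ← Finset.sum_add_distrib]
  refine Finset.sum_congr rfl fun i _ => ?_
  rw [zsmul_phase, zsmul_phase, latticeVec_neg, ← AddCircle.coe_add, ← mul_add, twoSidedY]

section Limits

variable {γ : ℝ → Plane} {Ω : Set Plane} {μ ν : Measure LatticeSpace} [SFinite μ]
  [SMulInvariantMeasure SL2R LatticeSpace μ]

theorem aemeasurable_phase (h : IsAnalyticOval γ Ω) (k : ℤ × ℤ) (t : ℝ) :
    AEMeasurable (phase γ k t) μ :=
  ((AddCircle.continuous_mk' 1).comp
    (h.continuous_curveY.const_mul t)).measurable.comp_aemeasurable (aemeasurable_latticeVec k)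

theorem tendsto_integral_phase [IsFiniteMeasure ν] (h : IsAnalyticOval γ Ω) (hν : ν ≪ μ)
    {ι : Type*} (S : Finset ι) {k : ι → ℤ × ℤ} (hk : ∀ i, k i ∈ PrimeIndex)
    (hinj : Function.Injective k) {p q : ι → ℤ} {i₀ : ι} (hi₀ : i₀ ∈ S)
    (hpq : p i₀ ≠ 0 ∨ q i₀ ≠ 0) (hsym : q i₀ = 0 ∨ ¬ HasCenterOfSymmetry Ω)
    {ψ : LatticeSpace → ℂ} (hψ : Integrable ψ ν) :
    Tendsto (fun t : ℝ => ∫ L, ψ L * expCircle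
      (∑ i ∈ S, p i • phase γ (k i) t L + ∑ i ∈ S, q i • phase γ (-k i) t L) ∂ν)
      atTop (𝓝 0) := by
  simp only [sum_phase_eq]
  have hF : AEMeasurable
      (fun L => ∑ i ∈ S, twoSidedY γ (p i) (q i) (latticeVec (k i) L)) μ :=
    Finset.aemeasurable_fun_sum _ fun i _ =>
      (h.continuous_twoSidedY _ _).measurable.comp_aemeasurable (aemeasurable_latticeVec _)
  have hac : μ.map (fun L => ∑ i ∈ S, twoSidedY γ (p i) (q i) (latticeVec (k i) L)) ≪ volume :=
    map_sum_latticeVec_absolutelyContinuous (Φ := fun i => twoSidedY γ (p i) (q i)) hi₀ hk hinj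
      (fun i _ => h.continuous_twoSidedY _ _) (fun i _ ξ c hc => h.twoSidedY_smul _ _ ξ hc)
      (fun i _ w w' hw => h.ae_analyticAt_twoSidedY_line _ _ hw)
      fun w w' hw => h.twoSidedY_line_not_affine (hpq.imp Int.cast_ne_zero.2 Int.cast_ne_zero.2)
        (Or.inr (hsym.imp_left Int.cast_eq_zero.2)) hw
  exact tendsto_integral_mul_expCircle (hF.mono_ac hν)
    ((absolutelyContinuous_map_of_aemeasurable hν hF).trans hac) hψ

theorem tendsto_setIntegral_phase [IsFiniteMeasure ν] (h : IsAnalyticOval γ Ω) (hν : ν ≪ μ)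
    {m n : PrimeIndex →₀ ℤ} (hmn : (m, n) ≠ 0) (hsym : n = 0 ∨ ¬ HasCenterOfSymmetry Ω)
    (s : Set LatticeSpace) :
    Tendsto (fun t : ℝ => ∫ L in s, expCircle
      (torusPairing m (fun k => phase γ k t L) + torusPairing n (fun k => phase γ (-k) t L)) ∂ν)
      atTop (𝓝 0) := by
  classical
  obtain ⟨i, hi⟩ : ∃ i, m i ≠ 0 ∨ n i ≠ 0 := by
    by_contra! hzero
    exact hmn (Prod.ext (Finsupp.ext fun i => (hzero i).1) (Finsupp.ext fun i => (hzero i).2))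
  have hiS : i ∈ m.support ∪ n.support := by
    simpa only [Finset.mem_union, Finsupp.mem_support_iff] using hi
  have hlim := tendsto_integral_phase (ν := ν.restrict s) h
    (Measure.restrict_le_self.absolutelyContinuous.trans hν) (m.support ∪ n.support)
    (k := fun k : PrimeIndex => (k : ℤ × ℤ)) (fun k => k.2) Subtype.val_injective
    hiS hi (hsym.imp_left fun hn => by rw [hn, Finsupp.zero_apply]) (integrable_const (1 : ℂ))
  simpa only [torusPairing_eq_sum (Finset.subset_union_left (s₁ := m.support) (s₂ := n.support)),
    torusPairing_eq_sum (Finset.subset_union_right (s₁ := m.support) (s₂ := n.support)), one_mul]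
    using hlim

variable [IsProbabilityMeasure ν]

theorem tendstoInDistribution_phases (h : IsAnalyticOval γ Ω) (hν : ν ≪ μ) :
    TendstoInDistribution
      (fun (t : ℝ) (L : LatticeSpace) => (L, fun k : PrimeIndex => phase γ k t L))
      atTop (id : LatticeSpace × (PrimeIndex → UnitAddCircle) → _)
      (fun _ => ν) (ν.prod uniformPhases) := by
  refine tendstoInDistribution_of_characters
    (fun t => (aemeasurable_pi_lambda _ fun k => aemeasurable_phase h _ t).mono_ac hν)
    exists_torusPairing_ne integral_torusPairing_eq_zero fun n hn s _ => ?_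
  simpa only [map_zero, ContinuousMap.zero_apply, add_zero]
    using tendsto_setIntegral_phase h hν (fun h0 => hn (congrArg Prod.fst h0)) (Or.inl rfl) s

theorem tendstoInDistribution_symmetric_phases (h : IsAnalyticOval γ Ω)
    (hsym : ¬ HasCenterOfSymmetry Ω) (hν : ν ≪ μ) :
    TendstoInDistribution
      (fun (t : ℝ) (L : LatticeSpace) =>
        (L, (fun k : PrimeIndex => phase γ k t L), fun k : PrimeIndex => phase γ (-k) t L))
      atTop
      (id : LatticeSpace × (PrimeIndex → UnitAddCircle) × (PrimeIndex → UnitAddCircle) → _)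
      (fun _ => ν) (ν.prod (uniformPhases.prod uniformPhases)) := by
  have : SecondCountableTopologyEither (PrimeIndex → UnitAddCircle) (PrimeIndex → UnitAddCircle) :=
    ⟨Or.inl inferInstance⟩
  have : BorelSpace ((PrimeIndex → UnitAddCircle) × (PrimeIndex → UnitAddCircle)) :=
    Prod.borelSpace
  exact tendstoInDistribution_of_characters
    (fun t => ((aemeasurable_pi_lambda _ fun k => aemeasurable_phase h _ t).prodMk
      (aemeasurable_pi_lambda _ fun k => aemeasurable_phase h _ t)).mono_ac hν)
    (exists_prodPairing_ne exists_torusPairing_ne exists_torusPairing_ne)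
    (integral_prodPairing_eq_zero integral_torusPairing_eq_zero integral_torusPairing_eq_zero)
    fun a ha s _ => tendsto_setIntegral_phase h hν ha (Or.inr hsym) s

end Limits

end

theorem proposition12_general {γ : ℝ → Plane} {Ω : Set Plane} (hγ : IsAnalyticOval γ Ω)
    {μ : Measure LatticeSpace} [SFinite μ] [SMulInvariantMeasure SL2R LatticeSpace μ]
    {ν : Measure LatticeSpace} [IsProbabilityMeasure ν] (hν : ν ≪ μ) :
    (∀ (l : ℕ) (ψ : LatticeSpace → ℂ), Integrable ψ ν →
      ∀ k : Fin l → ℤ × ℤ, (∀ h, k h ∈ PrimeIndex) → Function.Injective k →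
      ∀ p : Fin l → ℤ, p ≠ 0 →
        Tendsto (fun t : ℝ => ∫ L, ψ L * expCircle (∑ h, p h • phase γ (k h) t L) ∂ν)
          atTop (𝓝 0)) ∧
    TendstoInDistribution
      (fun (t : ℝ) (L : LatticeSpace) => (L, fun k : PrimeIndex => phase γ k t L))
      atTop (id : LatticeSpace × (PrimeIndex → UnitAddCircle) → _)
      (fun _ => ν) (ν.prod uniformPhases) ∧
    (¬ HasCenterOfSymmetry Ω →
      (∀ (l : ℕ) (ψ : LatticeSpace → ℂ), Integrable ψ ν →
        ∀ k : Fin l → ℤ × ℤ, (∀ h, k h ∈ PrimeIndex) → Function.Injective k →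
        ∀ p q : Fin l → ℤ, (p, q) ≠ 0 →
          Tendsto (fun t : ℝ => ∫ L, ψ L * expCircle
              (∑ h, p h • phase γ (k h) t L + ∑ h, q h • phase γ (-k h) t L) ∂ν)
            atTop (𝓝 0)) ∧
      TendstoInDistribution
        (fun (t : ℝ) (L : LatticeSpace) =>
          (L, (fun k : PrimeIndex => phase γ k t L), fun k : PrimeIndex => phase γ (-k) t L))
        atTop
        (id : LatticeSpace × (PrimeIndex → UnitAddCircle) × (PrimeIndex → UnitAddCircle) → _)
        (fun _ => ν) (ν.prod (uniformPhases.prod uniformPhases))) := by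
  refine ⟨fun l ψ hψ k hk hinj p hp => ?_, tendstoInDistribution_phases hγ hν,
    fun hsym => ⟨fun l ψ hψ k hk hinj p q hpq => ?_,
      tendstoInDistribution_symmetric_phases hγ hsym hν⟩⟩
  · obtain ⟨i, hi⟩ := Function.ne_iff.1 hp
    simpa only [Pi.zero_apply, zero_smul, Finset.sum_const_zero, add_zero]
      using tendsto_integral_phase hγ hν Finset.univ hk hinj (p := p) (q := 0)
        (Finset.mem_univ i) (Or.inl hi) (Or.inl rfl) hψ
  · obtain ⟨i, hi⟩ : ∃ i, p i ≠ 0 ∨ q i ≠ 0 := by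
      by_contra! hzero
      exact hpq (Prod.ext (funext fun i => (hzero i).1) (funext fun i => (hzero i).2))
    exact tendsto_integral_phase hγ hν Finset.univ hk hinj (Finset.mem_univ i) hi (Or.inr hsym) hψ

theorem proposition12
    (γ : ℝ → Plane) (Ω : Set Plane) (hγ : IsAnalyticOval γ Ω)
    -- the invariant (Haar) probability measure `μ` on the space of lattices
    (μ : Measure LatticeSpace) [IsProbabilityMeasure μ] [SMulInvariantMeasure SL2R LatticeSpace μ]
    -- the probability measure `ν` with smooth bounded density `σ` with respect to `μ`
    (σ : LatticeSpace → ℝ) (hσ_smooth : IsSmoothOnLattices σ) (hσ_nonneg : ∀ L, 0 ≤ σ L)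
    (hσ_bdd : ∃ C : ℝ, ∀ L, σ L ≤ C)
    (ν : Measure LatticeSpace) [IsProbabilityMeasure ν]
    (hν : ν = μ.withDensity fun L => ENNReal.ofReal (σ L)) :
    (∀ (l : ℕ) (ψ : LatticeSpace → ℂ), IsSmoothOnLattices ψ → HasCompactSupport ψ →
      ∀ k : Fin l → ℤ × ℤ, (∀ h, k h ∈ PrimeIndex) → Function.Injective k →
      ∀ p : Fin l → ℤ, p ≠ 0 →
        Tendsto (fun t : ℝ => ∫ L, ψ L * expCircle (∑ h, p h • phase γ (k h) t L) ∂ν)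
          atTop (𝓝 0)) ∧
    TendstoInDistribution
      (fun (t : ℝ) (L : LatticeSpace) => (L, fun k : PrimeIndex => phase γ k t L))
      atTop (id : LatticeSpace × (PrimeIndex → UnitAddCircle) → _)
      (fun _ => ν) (ν.prod uniformPhases) ∧
    (¬ HasCenterOfSymmetry Ω →
      (∀ (l : ℕ) (ψ : LatticeSpace → ℂ), IsSmoothOnLattices ψ → HasCompactSupport ψ →
        ∀ k : Fin l → ℤ × ℤ, (∀ h, k h ∈ PrimeIndex) → Function.Injective k →
        ∀ p q : Fin l → ℤ, (p, q) ≠ 0 →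
          Tendsto (fun t : ℝ => ∫ L, ψ L * expCircle
              (∑ h, p h • phase γ (k h) t L + ∑ h, q h • phase γ (-k h) t L) ∂ν)
            atTop (𝓝 0)) ∧
      TendstoInDistribution
        (fun (t : ℝ) (L : LatticeSpace) =>
          (L, (fun k : PrimeIndex => phase γ k t L), fun k : PrimeIndex => phase γ (-k) t L))
        atTop
        (id : LatticeSpace × (PrimeIndex → UnitAddCircle) × (PrimeIndex → UnitAddCircle) → _)
        (fun _ => ν) (ν.prod (uniformPhases.prod uniformPhases))) := by
  have hac : ν ≪ μ := hν ▸ withDensity_absolutelyContinuous _ _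
  obtain ⟨hphase, hlaw, hsymm⟩ := proposition12_general hγ hac
  exact ⟨fun l ψ hψ hsupp => hphase l ψ (hψ.integrable hsupp ν), hlaw,
    fun hsym => ⟨fun l ψ hψ hsupp => (hsymm hsym).1 l ψ (hψ.integrable hsupp ν), (hsymm hsym).2⟩⟩
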